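/- For natural numbers $q\ge 1$ and $0\le p\le q-1$ let $\beta_{p,q}:[0,1]\to\mathbb{R}$ be the piecewise linear function $$\beta_{p,q}(x)=\begin{cases}0 & \text{if } 0\le x\le \frac pq,\\ 2^q\left(x-\frac pq\right) & \text{if } \frac pq\le x\le \frac{p+2^{-q}}{q},\\ \frac1q & \text{if } \frac{p+2^{-q}}{q}\le x\le 1,\end{cases}$$ and let $$\alpha_q=\sum_{p=0}^{q-1}\beta_{p,q},\qquad \mathcal F(x)=\sum_{q=1}^{\infty}\frac1{q^2}\,\alpha_q(x)\qquad(x\in[0,1]).$$ Let $\mathbf D$ be the set of dyadic rational numbers, and for a real number $x$ let $CF_x$ be the set of all functions $\phi:\mathbb N\to\mathbf D$ with $|\phi(n)-x|\le 2^{-n}$ for all $n\in\mathbb N$. **Theorem.** $\mathcal F$ is an exponential time computable real function on $[0,1]$, that is, $\mathcal F\in\mathrm{FEXPTIME}_{C[0,1]}$: there are a function-oracle Turing machine $M$ and a constant $C\in\mathbb N$ such that for every $x\in[0,1]$ and every $\phi\in CF_x$ the function $\psi$ computed by $M$ with oracle $\phi$ is in $CF_{\mathcal F(x)}$, and, for every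 $n\in\mathbb N$, $M$ computes $\psi(n)$ in at most $2^{C(n+1)}$ steps. Here the arguments of $\phi$ and $\psi$ are written in unary, dyadic rationals are written as finite binary expansions (without superfluous zeros), and a query to the oracle costs one step. -/

import Mathlib

/-! ### Oracle Turing machines

The base model is the multi-stack form `Turing.TM2` of Turing machines: finitely many stacks (a tape
is a pair of stacks) and a finite control. It is extended by a function oracle `ℕ → D`, where `D` is
the set of dyadic rational numbers. -/

/-- The symbols in which dyadic rationals are written. -/
inductive DyadicSymbol where
  | minus
  | point
  | bit (b : Bool)
deriving DecidableEq, Fintype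

/-- The finite binary expansion of a dyadic rational `d`: a minus sign if `d < 0`, then the binary
digits of the integer part of `|d|`, most significant first and without leading zeros, then the
binary point, then the binary digits of the fractional part of `|d|`, without trailing zeros.
(The reduced denominator of `d` is `2 ^ k`, where `k` is the number of fractional digits.) -/
def Dyadic.expansion (d : Dyadic) : List DyadicSymbol :=
  let m : ℕ := d.toRat.num.natAbs
  let k : ℕ := Nat.log 2 d.toRat.den
  (if d.toRat < 0 then [DyadicSymbol.minus] else []) ++
    (Nat.bits (m / 2 ^ k)).reverse.map DyadicSymbol.bit ++
    [DyadicSymbol.point] ++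
    (List.range k).reverse.map (fun i => DyadicSymbol.bit (m.testBit i))

/-- A function-oracle Turing machine: finitely many stacks over a finite alphabet, finitely many
labels, finitely many values of the internal variable, a program, and a query and an answer label. -/
structure OracleTM where
  /-- index type of the stacks -/
  K : Type
  [decEqK : DecidableEq K]
  [finK : Fintype K]
  /-- input, output and query stack -/
  (input output query : K)
  /-- the alphabet, which contains the symbols in which numbers are written -/
  Γ : Type
  [finΓ : Fintype Γ]
  symbol : DyadicSymbol ↪ Γ
  /-- labels of the program -/
  Λ : Type
  [decEqΛ : DecidableEq Λ]
  [finΛ : Fintype Λ]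
  /-- the label at which the computation starts, the query label, and the label at which the
  computation resumes after a query -/
  (start ask resume : Λ)
  /-- values of the internal variable of the finite control -/
  σ : Type
  [finσ : Fintype σ]
  initial : σ
  /-- the program -/
  program : Λ → Turing.TM2.Stmt (fun _ : K => Γ) Λ σ

namespace OracleTM

attribute [instance] decEqK finK finΓ decEqΛ finΛ finσ

/-- Configurations; the label is `none` exactly when the machine has halted. -/
abbrev Cfg (M : OracleTM) : Type :=
  Turing.TM2.Cfg (fun _ : M.K => M.Γ) M.Λ M.σ

/-- The initial configuration on input `n`, given in unary on the input stack. -/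
def init (M : OracleTM) (n : ℕ) : M.Cfg where
  l := some M.start
  var := M.initial
  stk := Function.update (fun _ => []) M.input
    (List.replicate n (M.symbol (DyadicSymbol.bit true)))

/-- One step of the machine `M` with oracle `φ`. At the query label, the string on the query stack,
read as a number in unary (`m` is the length of the string), is replaced by the binary
expansion of `φ m`, with its first symbol on top; a query costs one step. At every other label the
statement of the program at this label is executed. A configuration that has halted stays. -/
def step (M : OracleTM) (φ : ℕ → Dyadic) : M.Cfg → M.Cfg
  | ⟨none, v, S⟩ => ⟨none, v, S⟩
  | ⟨some l, v, S⟩ =>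
    if l = M.ask then
      ⟨some M.resume, v,
        Function.update S M.query ((φ (S M.query).length).expansion.map M.symbol)⟩
    else Turing.TM2.stepAux (M.program l) v S

/-- On input `n`, the machine `M` with oracle `φ` halts after at most `T` steps, and then its output
stack holds the binary expansion of `d`. -/
def OutputsWithin (M : OracleTM) (φ : ℕ → Dyadic) (n : ℕ) (d : Dyadic) (T : ℕ) : Prop :=
  ∃ t ≤ T, ((M.step φ)^[t] (M.init n)).l = none ∧
    ((M.step φ)^[t] (M.init n)).stk M.output = d.expansion.map M.symbol

end OracleTM

/-! ### Computable real functions -/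

/-- `CF x` is the set of the functions `φ : ℕ → D` that binary converge to `x`. -/
def CF (x : ℝ) : Set (ℕ → Dyadic) :=
  {φ | ∀ n : ℕ, |((φ n).toRat : ℝ) - x| ≤ 2 ^ (-(n : ℤ))}

/-- The real functions `f` on `[a, b]` for which there is an oracle Turing machine `M` such that, for
all `x ∈ [a, b]` and all `φ ∈ CF x`, the function `ψ` computed by `M` with oracle `φ` is in
`CF (f x)`, and `ψ n` is computed in at most `2 ^ (C * (n + 1))` steps, with `C` a constant. -/
def FEXPTIME (a b : ℝ) : Set (Set.Icc a b → ℝ) :=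
  {f | ∃ (M : OracleTM) (C : ℕ), ∀ x : Set.Icc a b, ∀ φ ∈ CF x, ∃ ψ ∈ CF (f x),
    ∀ n : ℕ, M.OutputsWithin φ n (ψ n) (2 ^ (C * (n + 1)))}

/-! ### The function `F` -/

noncomputable section

/-- The function `β_{p,q}` (used for `q ≥ 1`, `p < q`, on `[0, 1]`). -/
def beta (p q : ℕ) (x : ℝ) : ℝ :=
  if x ≤ (p : ℝ) / q then 0
  else if x ≤ ((p : ℝ) + 1 / 2 ^ q) / q then 2 ^ q * (x - (p : ℝ) / q)
  else 1 / q

/-- The function `α_q = ∑_{p = 0}^{q - 1} β_{p,q}`. -/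
def alpha (q : ℕ) (x : ℝ) : ℝ :=
  ∑ p ∈ Finset.range q, beta p q x

/-- The function `F = ∑_{q ≥ 1} α_q / q ^ 2` on `[0, 1]`. -/
def F (x : Set.Icc (0 : ℝ) 1) : ℝ :=
  ∑' q : ℕ, 1 / ((q + 1 : ℕ) : ℝ) ^ 2 * alpha (q + 1) x

end

theorem beta_mem (p q : ℕ) (hq : 1 ≤ q) (x : ℝ) : 0 ≤ beta p q x ∧ beta p q x ≤ 1 / q := by
  have hq' : (0 : ℝ) < q := by exact_mod_cast hq
  unfold beta
  split_ifs with h1 h2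
  · exact ⟨le_rfl, by positivity⟩
  · push Not at h1
    refine ⟨mul_nonneg (by positivity) (by linarith), ?_⟩
    have h3 : x - (p : ℝ) / q ≤ 1 / 2 ^ q / q := by
      rw [add_div] at h2
      linarith
    calc (2 : ℝ) ^ q * (x - (p : ℝ) / q) ≤ 2 ^ q * (1 / 2 ^ q / q) := by gcongr
      _ = 1 / q := by field_simp
  · exact ⟨by positivity, le_rfl⟩

theorem alpha_mem (q : ℕ) (hq : 1 ≤ q) (x : ℝ) : 0 ≤ alpha q x ∧ alpha q x ≤ 1 := by
  have hq' : (q : ℝ) ≠ 0 := by positivity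
  refine ⟨Finset.sum_nonneg fun p _ => (beta_mem p q hq x).1, ?_⟩
  calc alpha q x ≤ ∑ p ∈ Finset.range q, (1 / q : ℝ) :=
        Finset.sum_le_sum fun p _ => (beta_mem p q hq x).2
    _ = 1 := by simp [hq']

/-- The series that defines `F` converges (absolutely), so its `tsum` is its sum. -/
theorem F_summable (x : Set.Icc (0 : ℝ) 1) :
    Summable fun q : ℕ => 1 / ((q + 1 : ℕ) : ℝ) ^ 2 * alpha (q + 1) x := by
  have h : Summable fun q : ℕ => 1 / ((q + 1 : ℕ) : ℝ) ^ 2 :=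
    (summable_nat_add_iff 1).2 (Real.summable_one_div_nat_pow.2 one_lt_two)
  refine Summable.of_nonneg_of_le (fun q => ?_) (fun q => ?_) h
  · exact mul_nonneg (by positivity) (alpha_mem _ (by omega) _).1
  · exact mul_le_of_le_one_right (by positivity) (alpha_mem _ (by omega) _).2

/-! Since `alpha` takes values in [0,1], the first N = 2^(n+3) terms of the series determine `F x`
up to 1/N. The function `alpha q` is Lipschitz with constant q·2^q, so it is known to within about
2^(-k) once x is known to k+q binary digits. For q ≤ N one query at N+k, with k = 2(n+3), serves all
terms. Its argument is exponential in n, which the time bound allows. The answer may be arbitrarily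
long, but only its first k+q digits are read.

The difficulty is the slope 2^q: the number formed by k+q digits is doubly exponential in n and
cannot be held in unary. If d_j is the number formed by the first j digits, then
q·2^k·β_{p,q}(d_(k+q)/2^(k+q)) is A_(k+q) clamped to [0, 2^k], where A_j = q·d_j - p·2^j. Here
A_(j+1) is 2·A_j, plus q if the new digit is 1. Once A_j ≥ 2^k or A_j ≤ -q, it stays there for ever,
so the recursion may be clamped to [-q, 2^k] at every step without changing the final result
(`accVal_eq`, `sumVal_eq`). The values kept are then polynomial in N, and unary arithmetic is fast
enough.

The only errors are the digits of x and the roundings in three divisions (`abs_termVal_sub_le`), and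
the tail (`abs_sum_sub_F_le`). On the machine side, programs of a small while language are compiled
to stack machines (`reachesIn_code`); a bound B on the iterations of every loop gives a running time
polynomial in B (`exists_cost_le_pow`), and B = N^5 suffices. -/

/-! ### A while language on stacks -/

/-- Programs of a while language on stacks. `ite k c p q` branches on the top of stack `k`;
`loop k p` pops a symbol from stack `k` and executes `p`, until stack `k` is empty. -/
inductive StackProg (K Γ : Type) where
  | skip
  | push (k : K) (g : Γ)
  | pop (k : K)
  | seq (p q : StackProg K Γ)
  | ite (k : K) (c : Option Γ → Bool) (p q : StackProg K Γ)
  | loop (k : K) (p : StackProg K Γ)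

namespace StackProg

infixr:60 " ;; " => StackProg.seq

/-- `loopRel k R N S S'`: starting from `S`, the loop on stack `k` with body `R` ends in `S'` after
`N` iterations. -/
def loopRel {K Γ : Type} [DecidableEq K] (k : K)
    (R : (K → List Γ) → (K → List Γ) → Prop) : ℕ → (K → List Γ) → (K → List Γ) → Prop
  | 0, S, S' => S k = [] ∧ S' = S
  | N + 1, S, S' => S k ≠ [] ∧
      ∃ S₁, R (Function.update S k (S k).tail) S₁ ∧ loopRel k R N S₁ S'

/-- `p.Exec B S S'`: the program `p` leads from `S` to `S'`, and each execution of a loop takes at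
most `B` iterations. -/
def Exec {K Γ : Type} [DecidableEq K] (B : ℕ) :
    StackProg K Γ → (K → List Γ) → (K → List Γ) → Prop
  | skip, S, S' => S' = S
  | push k g, S, S' => S' = Function.update S k (g :: S k)
  | pop k, S, S' => S' = Function.update S k (S k).tail
  | seq p q, S, S' => ∃ S₁, Exec B p S S₁ ∧ Exec B q S₁ S'
  | ite k c p q, S, S' => (c (S k).head? = true ∧ Exec B p S S') ∨
      (c (S k).head? = false ∧ Exec B q S S')
  | loop k p, S, S' => ∃ N ≤ B, loopRel k (Exec B p) N S S'

/-- A bound for the number of machine steps, if loops take at most `B` iterations. -/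
def cost {K Γ : Type} (B : ℕ) : StackProg K Γ → ℕ
  | skip => 1
  | push _ _ => 1
  | pop _ => 1
  | seq p q => cost B p + cost B q
  | ite _ _ p q => 1 + cost B p + cost B q
  | loop _ p => B * (1 + cost B p) + 1

/-- For a fixed program the cost is a polynomial in B, whose degree is the nesting depth of the
loops. The condition 3 ≤ B lets a sum of three powers be absorbed by raising the exponent. -/
theorem exists_cost_le_pow {K Γ : Type} (p : StackProg K Γ) :
    ∃ E : ℕ, ∀ B : ℕ, 3 ≤ B → cost B p ≤ B ^ E := by
  have key : ∀ B E F : ℕ, 3 ≤ B → 1 + B ^ E + B ^ F ≤ B ^ (E + F + 1) := by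
    intro B E F hB
    have h1 : B ^ E ≤ B ^ (E + F) := Nat.pow_le_pow_right (by omega) (by omega)
    have h2 : B ^ F ≤ B ^ (E + F) := Nat.pow_le_pow_right (by omega) (by omega)
    have h3 : 1 ≤ B ^ (E + F) := Nat.one_le_pow _ _ (by omega)
    have h4 : B ^ (E + F) * 3 ≤ B ^ (E + F) * B := Nat.mul_le_mul_left _ hB
    rw [pow_succ]
    omega
  induction p with
  | skip => exact ⟨0, fun B _ => by simp [cost]⟩
  | push k g => exact ⟨0, fun B _ => by simp [cost]⟩
  | pop k => exact ⟨0, fun B _ => by simp [cost]⟩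
  | seq p q hp hq =>
    obtain ⟨E, hE⟩ := hp
    obtain ⟨F, hF⟩ := hq
    refine ⟨E + F + 1, fun B hB => le_trans ?_ (key B E F hB)⟩
    have := hE B hB
    have := hF B hB
    simp only [cost]
    omega
  | ite k c p q hp hq =>
    obtain ⟨E, hE⟩ := hp
    obtain ⟨F, hF⟩ := hq
    refine ⟨E + F + 1, fun B hB => le_trans ?_ (key B E F hB)⟩
    have := hE B hB
    have := hF B hB
    simp only [cost]
    omega
  | loop k p hp =>
    obtain ⟨E, hE⟩ := hp
    refine ⟨E + 3, fun B hB => ?_⟩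
    have h1 := hE B hB
    have h2 : 1 ≤ B ^ E := Nat.one_le_pow _ _ (by omega)
    simp only [cost]
    calc B * (1 + cost B p) + 1 ≤ B * (B ^ E + B ^ E) + B ^ E := by gcongr
      _ = B ^ E * (2 * B + 1) := by ring
      _ ≤ B ^ E * B ^ 3 := by gcongr; nlinarith [mul_self_nonneg B, Nat.mul_le_mul hB hB]
      _ = B ^ (E + 3) := by ring

/-! ### Compilation to Turing machines -/

/-- The labels of the compiled program. -/
def Label {K Γ : Type} : StackProg K Γ → Type
  | skip => Unit
  | push _ _ => Unit
  | pop _ => Unit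
  | seq p q => Label p ⊕ Label q
  | ite _ _ p q => Option (Label p ⊕ Label q)
  | loop _ p => Option (Label p)

instance finite_label {K Γ : Type} (p : StackProg K Γ) : Finite (Label p) := by
  induction p with
  | skip => exact inferInstanceAs (Finite Unit)
  | push k g => exact inferInstanceAs (Finite Unit)
  | pop k => exact inferInstanceAs (Finite Unit)
  | seq p q hp hq => exact inferInstanceAs (Finite (Label p ⊕ Label q))
  | ite k c p q hp hq => exact inferInstanceAs (Finite (Option (Label p ⊕ Label q)))
  | loop k p hp => exact inferInstanceAs (Finite (Option (Label p)))

/-- The label at which the compiled program starts. -/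
def entry {K Γ : Type} : (p : StackProg K Γ) → Label p
  | skip => ()
  | push _ _ => ()
  | pop _ => ()
  | seq p _ => Sum.inl (entry p)
  | ite _ _ _ _ => none
  | loop _ _ => none

/-- The compiled program, where `f` embeds the labels, and `x` is the label to go to at the end. -/
def code {K Γ Λ : Type} : (p : StackProg K Γ) → (Label p → Λ) → Λ → Label p →
    Turing.TM2.Stmt (fun _ : K => Γ) Λ (Option Γ)
  | skip, _, x, _ => .goto fun _ => x
  | push k g, _, x, _ => .push k (fun _ => g) (.goto fun _ => x)
  | pop k, _, x, _ => .pop k (fun v _ => v) (.goto fun _ => x)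
  | seq p q, f, _, .inl l => code p (f ∘ Sum.inl) (f (.inr (entry q))) l
  | seq _ q, f, x, .inr l => code q (f ∘ Sum.inr) x l
  | ite k c p q, f, _, none => .peek k (fun _ a => a) (.branch c
      (.load (fun _ => none) (.goto fun _ => f (some (.inl (entry p)))))
      (.load (fun _ => none) (.goto fun _ => f (some (.inr (entry q))))))
  | ite _ _ p _, f, x, some (.inl l) => code p (f ∘ some ∘ Sum.inl) x l
  | ite _ _ _ q, f, x, some (.inr l) => code q (f ∘ some ∘ Sum.inr) x l
  | loop k p, f, x, none => .pop k (fun _ a => a) (.branch Option.isSome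
      (.load (fun _ => none) (.goto fun _ => f (some (entry p))))
      (.load (fun _ => none) (.goto fun _ => x)))
  | loop _ p, f, _, some l => code p (f ∘ some) (f none) l

end StackProg

namespace OracleTM

/-- `M.ReachesIn φ T c c'`: the machine gets from `c` to `c'` in at most `T` steps. -/
def ReachesIn (M : OracleTM) (φ : ℕ → Dyadic) (T : ℕ) (c c' : M.Cfg) : Prop :=
  ∃ t ≤ T, (M.step φ)^[t] c = c'

theorem ReachesIn.trans {M : OracleTM} {φ : ℕ → Dyadic} {T T' : ℕ} {c c' c'' : M.Cfg}
    (h : M.ReachesIn φ T c c') (h' : M.ReachesIn φ T' c' c'') : M.ReachesIn φ (T + T') c c'' := by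
  obtain ⟨t, ht, rfl⟩ := h
  obtain ⟨t', ht', rfl⟩ := h'
  exact ⟨t' + t, by omega, by rw [Function.iterate_add_apply]⟩

theorem ReachesIn.mono {M : OracleTM} {φ : ℕ → Dyadic} {T T' : ℕ} {c c' : M.Cfg}
    (h : M.ReachesIn φ T c c') (hT : T ≤ T') : M.ReachesIn φ T' c c' :=
  let ⟨t, ht, e⟩ := h
  ⟨t, ht.trans hT, e⟩

theorem ReachesIn.single {M : OracleTM} {φ : ℕ → Dyadic} {c c' : M.Cfg}
    (h : M.step φ c = c') : M.ReachesIn φ 1 c c' := ⟨1, le_rfl, h⟩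

theorem step_of_ne_ask {M : OracleTM} {φ : ℕ → Dyadic} {l : M.Λ} (h : l ≠ M.ask)
    {s : Turing.TM2.Stmt (fun _ : M.K => M.Γ) M.Λ M.σ} (hs : M.program l = s) (v : M.σ)
    (S : M.K → List M.Γ) {c : M.Cfg} (hc : Turing.TM2.stepAux s v S = c) :
    M.step φ ⟨some l, v, S⟩ = c := by
  rw [← hc, ← hs]
  simp [step, h]

end OracleTM

/-- The machine with a program to be executed before and one to be executed after the query. -/
noncomputable def queryMachine (K : Type) [DecidableEq K] [Fintype K] (input output query : K)
    (p q : StackProg K DyadicSymbol) : OracleTM where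
  K := K
  input := input
  output := output
  query := query
  Γ := DyadicSymbol
  symbol := Function.Embedding.refl _
  Λ := (p.Label ⊕ q.Label) ⊕ Bool
  decEqΛ := Classical.decEq _
  finΛ := Fintype.ofFinite _
  start := .inl (.inl p.entry)
  ask := .inr false
  resume := .inl (.inr q.entry)
  σ := Option DyadicSymbol
  initial := none
  program
    | .inl (.inl l) => p.code (fun l => .inl (.inl l)) (.inr false) l
    | .inl (.inr l) => q.code (fun l => .inl (.inr l)) (.inr true) l
    | .inr _ => .halt

namespace StackProg

/-- The embedding `f` and the exit `x` are arbitrary so that the induction applies to a subprogram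
sitting inside a larger one. The internal variable is `none` at every entry and exit, because tests
reset it after use. -/
theorem reachesIn_code (K : Type) [DecidableEq K] [Fintype K] (i o u : K)
    (P₁ P₂ : StackProg K DyadicSymbol) (φ : ℕ → Dyadic) (B : ℕ)
    (p : StackProg K DyadicSymbol) :
    ∀ (f : p.Label → (P₁.Label ⊕ P₂.Label) ⊕ Bool) (x : (P₁.Label ⊕ P₂.Label) ⊕ Bool),
    (∀ l, (queryMachine K i o u P₁ P₂).program (f l) = p.code f x l) →
    (∀ l, f l ≠ .inr false) → ∀ S S' : K → List DyadicSymbol, p.Exec B S S' →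
    (queryMachine K i o u P₁ P₂).ReachesIn φ (p.cost B)
      ⟨some (f p.entry), none, S⟩ ⟨some x, none, S'⟩ := by
  induction p with
  | skip =>
    rintro f x hf hn S S' rfl
    refine .single ?_
    exact OracleTM.step_of_ne_ask (hn _) (hf _) _ _ rfl
  | push k g =>
    rintro f x hf hn S S' rfl
    refine .single ?_
    exact OracleTM.step_of_ne_ask (hn _) (hf _) _ _ rfl
  | pop k =>
    rintro f x hf hn S S' rfl
    refine .single ?_
    exact OracleTM.step_of_ne_ask (hn _) (hf _) _ _ rfl
  | seq p q hp hq =>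
    rintro f x hf hn S S' ⟨S₁, h1, h2⟩
    exact (hp (f ∘ Sum.inl) (f (.inr (entry q))) (fun l => hf (.inl l)) (fun l => hn _) S S₁ h1).trans
      (hq (f ∘ Sum.inr) x (fun l => hf (.inr l)) (fun l => hn _) S₁ S' h2)
  | ite k c p q hp hq =>
    rintro f x hf hn S S' (⟨hc, h⟩ | ⟨hc, h⟩)
    · have h1 : (queryMachine K i o u P₁ P₂).step φ ⟨some (f (entry (ite k c p q))), none, S⟩ =
          ⟨some (f (some (.inl (entry p)))), none, S⟩ := by
        refine OracleTM.step_of_ne_ask (hn _) (hf _) _ _ ?_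
        exact congrArg (fun b => cond b _ _) hc
      exact ((OracleTM.ReachesIn.single h1).trans
        (hp (f ∘ some ∘ Sum.inl) x (fun l => hf (some (.inl l))) (fun l => hn _) S S' h)).mono
        (by simp only [cost]; omega)
    · have h1 : (queryMachine K i o u P₁ P₂).step φ ⟨some (f (entry (ite k c p q))), none, S⟩ =
          ⟨some (f (some (.inr (entry q)))), none, S⟩ := by
        refine OracleTM.step_of_ne_ask (hn _) (hf _) _ _ ?_
        exact congrArg (fun b => cond b _ _) hc
      exact ((OracleTM.ReachesIn.single h1).trans
        (hq (f ∘ some ∘ Sum.inr) x (fun l => hf (some (.inr l))) (fun l => hn _) S S' h)).mono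
        (by simp only [cost]; omega)
  | loop k p hp =>
    rintro f x hf hn S S' ⟨N, hN, h⟩
    suffices H : ∀ N S, loopRel k (Exec B p) N S S' →
        (queryMachine K i o u P₁ P₂).ReachesIn φ (N * (1 + p.cost B) + 1)
          ⟨some (f none), none, S⟩ ⟨some x, none, S'⟩ from
      (H N S h).mono (by simp only [cost]; gcongr)
    intro N
    induction N with
    | zero =>
      rintro S ⟨hS, rfl⟩
      refine OracleTM.ReachesIn.mono (.single ?_) (Nat.le_add_left _ _)
      refine OracleTM.step_of_ne_ask (hn _) (hf _) _ _ ?_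
      have h1 : (S' k).head?.isSome = false := by rw [hS]; rfl
      -- The last test pops from an empty stack and so changes nothing; it accounts for the `+ 1`.
      have h2 : Function.update S' k (S' k).tail = S' := by
        rw [hS, List.tail_nil, ← hS, Function.update_eq_self]
      exact (congrArg (fun b => cond b _ _) h1).trans
        (congrArg (fun T => (⟨some x, none, T⟩ : (queryMachine K i o u P₁ P₂).Cfg)) h2)
    | succ N ih =>
      rintro S ⟨hS, S₁, h1, h2⟩
      have h3 : (queryMachine K i o u P₁ P₂).step φ ⟨some (f none), none, S⟩ =
          ⟨some (f (some (entry p))), none, Function.update S k (S k).tail⟩ := by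
        refine OracleTM.step_of_ne_ask (hn _) (hf _) _ _ ?_
        have h1 : (S k).head?.isSome = true := by
          obtain ⟨a, l, e⟩ := List.exists_cons_of_ne_nil hS
          rw [e]; rfl
        exact congrArg (fun b => cond b _ _) h1
      exact (((OracleTM.ReachesIn.single h3).trans (hp (f ∘ some) (f none)
        (fun l => hf (some l)) (fun l => hn _) _ S₁ h1)).trans (ih S₁ h2)).mono
        (by rw [Nat.add_mul]; omega)

end StackProg

/-- The two extra steps are the query and the halting statement. -/
theorem outputsWithin_queryMachine {K : Type} [DecidableEq K] [Fintype K] {input output query : K}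
    {p q : StackProg K DyadicSymbol} {φ : ℕ → Dyadic} {B n : ℕ} {d : Dyadic}
    {S S' : K → List DyadicSymbol}
    (hp : p.Exec B (Function.update (fun _ => []) input
      (List.replicate n (DyadicSymbol.bit true))) S)
    (hq : q.Exec B (Function.update S query (φ (S query).length).expansion) S')
    (hd : S' output = d.expansion) :
    (queryMachine K input output query p q).OutputsWithin φ n d (p.cost B + q.cost B + 2) := by
  have h1 := StackProg.reachesIn_code K input output query p q φ B p (fun l => .inl (.inl l))
    (.inr false) (fun l => rfl) (fun l => by simp) _ _ hp
  have h2 := StackProg.reachesIn_code K input output query p q φ B q (fun l => .inl (.inr l))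
    (.inr true) (fun l => rfl) (fun l => by simp) _ _ hq
  have h3 : (queryMachine K input output query p q).step φ ⟨some (.inr false), none, S⟩ =
      ⟨some (.inl (.inr q.entry)), none,
        Function.update S query (φ (S query).length).expansion⟩ := by
    refine (if_pos rfl).trans ?_
    change Turing.TM2.Cfg.mk _ _ (Function.update S query
      ((φ (S query).length).expansion.map (fun x => x))) = _
    rw [List.map_id']
    rfl
  have h4 : (queryMachine K input output query p q).step φ ⟨some (.inr true), none, S'⟩ =
      ⟨none, none, S'⟩ :=
    OracleTM.step_of_ne_ask (M := queryMachine K input output query p q)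
      (l := (.inr true : (p.Label ⊕ q.Label) ⊕ Bool))
      (fun h => Bool.noConfusion (Sum.inr.inj (h : Sum.inr true = Sum.inr false))) rfl _ _ rfl
  obtain ⟨t, ht, e⟩ := ((h1.trans (.single h3)).trans h2).trans (.single h4)
  refine ⟨t, by omega, ?_⟩
  have e' : ((queryMachine K input output query p q).step φ)^[t]
      ((queryMachine K input output query p q).init n) = ⟨none, none, S'⟩ := e
  rw [e']
  refine ⟨rfl, ?_⟩
  change S' output = d.expansion.map (fun x => x)
  rw [List.map_id', hd]

/-! ### The stacks of the machine and their numerical views -/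

/-- The counters of the machine, that is, the stacks of which only the length matters. -/
inductive Counter where
  | arg | left | prec | len | len' | cap | den | idx | idx' | pred | acc | dbl | sum | total | tmp | par
deriving DecidableEq

instance : Fintype Counter where
  elems := {.arg, .left, .prec, .len, .len', .cap, .den, .idx, .idx', .pred, .acc, .dbl, .sum,
    .total, .tmp, .par}
  complete r := by cases r <;> decide

/-- The stacks of the machine. -/
inductive Stack where
  | cnt (r : Counter)
  | query
  | aux
  | out
deriving DecidableEq, Fintype

/-- A partial description of the stacks: the lengths of the counters, the possible contents of the
query stack, and the contents of the two other stacks. -/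
structure View where
  cnt : Counter → ℕ
  query : Set (List DyadicSymbol)
  aux : List DyadicSymbol
  out : List DyadicSymbol

namespace View

/-- The stacks `S` have the description `v`. -/
structure Describes (v : View) (S : Stack → List DyadicSymbol) : Prop where
  cnt : ∀ r, (S (.cnt r)).length = v.cnt r
  query : S .query ∈ v.query
  aux : S .aux = v.aux
  out : S .out = v.out

/-- Change one counter. -/
def set (v : View) (r : Counter) (m : ℕ) : View :=
  { v with cnt := Function.update v.cnt r m }

@[simp] theorem cnt_set (v : View) (r : Counter) (m : ℕ) :
    (v.set r m).cnt = Function.update v.cnt r m := rfl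
@[simp] theorem query_set (v : View) (r : Counter) (m : ℕ) : (v.set r m).query = v.query := rfl
@[simp] theorem aux_set (v : View) (r : Counter) (m : ℕ) : (v.set r m).aux = v.aux := rfl
@[simp] theorem out_set (v : View) (r : Counter) (m : ℕ) : (v.set r m).out = v.out := rfl

theorem ext_cnt {v w : View} (h : ∀ r, v.cnt r = w.cnt r) (h₁ : v.query = w.query)
    (h₂ : v.aux = w.aux) (h₃ : v.out = w.out) : v = w := by
  obtain ⟨c, q, y, o⟩ := v
  obtain ⟨c', q', y', o'⟩ := w
  obtain rfl : c = c' := funext h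
  obtain rfl : q = q' := h₁
  obtain rfl : y = y' := h₂
  obtain rfl : o = o' := h₃
  rfl

end View

/-! ### Hoare-style rules for programs on the described stacks -/

open StackProg

/-- The program `p` leads from `v` to `w`, with at most `B` iterations of each loop. -/
def Run (B : ℕ) (v : View) (p : StackProg Stack DyadicSymbol) (w : View) : Prop :=
  ∀ S, v.Describes S → ∃ S', p.Exec B S S' ∧ w.Describes S'

/-- Increment a counter. -/
def inc (r : Counter) : StackProg Stack DyadicSymbol := .push (.cnt r) (.bit true)

/-- Decrement a counter. -/
def dec (r : Counter) : StackProg Stack DyadicSymbol := .pop (.cnt r)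

/-- Do `p` as long as the counter, which is decremented each time, is positive. -/
def loopc (r : Counter) (p : StackProg Stack DyadicSymbol) : StackProg Stack DyadicSymbol :=
  .loop (.cnt r) p

/-- Branch on whether the counter is positive. -/
def itec (r : Counter) (p q : StackProg Stack DyadicSymbol) : StackProg Stack DyadicSymbol :=
  .ite (.cnt r) Option.isSome p q

namespace Run

variable {B : ℕ} {v w x : View} {p p' : StackProg Stack DyadicSymbol}

theorem seq (h : Run B v p w) (h' : Run B w p' x) : Run B v (p ;; p') x := by
  intro S hS
  obtain ⟨S₁, h1, h2⟩ := h S hS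
  obtain ⟨S₂, h3, h4⟩ := h' S₁ h2
  exact ⟨S₂, ⟨S₁, h1, h3⟩, h4⟩

theorem skip (h : v = w) : Run B v .skip w := fun S hS => ⟨S, rfl, h ▸ hS⟩

theorem inc {r : Counter} (h : v.set r (v.cnt r + 1) = w) : Run B v (inc r) w := by
  subst h
  refine fun S hS => ⟨_, rfl, ?_, ?_, ?_, ?_⟩
  · intro s
    by_cases hs : s = r
    · subst hs; simp [hS.cnt]
    · simp [hs, hS.cnt]
  · simpa using hS.query
  · simpa using hS.aux
  · simpa using hS.out

theorem dec {r : Counter} (h : v.set r (v.cnt r - 1) = w) : Run B v (dec r) w := by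
  subst h
  refine fun S hS => ⟨_, rfl, ?_, ?_, ?_, ?_⟩
  · intro s
    by_cases hs : s = r
    · subst hs; simp [hS.cnt]
    · simp [hs, hS.cnt]
  · simpa using hS.query
  · simpa using hS.aux
  · simpa using hS.out

theorem itec {r : Counter} (h : 0 < v.cnt r → Run B v p w) (h' : v.cnt r = 0 → Run B v p' w) :
    Run B v (itec r p p') w := by
  intro S hS
  have hr := hS.cnt r
  cases e : S (.cnt r) with
  | nil =>
    obtain ⟨S', h1, h2⟩ := h' (by rw [← hr, e]; rfl) S hS
    exact ⟨S', Or.inr ⟨by rw [e]; rfl, h1⟩, h2⟩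
  | cons a l =>
    obtain ⟨S', h1, h2⟩ := h (by rw [← hr, e]; simp) S hS
    exact ⟨S', Or.inl ⟨by rw [e]; rfl, h1⟩, h2⟩

/-- `I i` describes the stacks after i rounds. The body may change the loop counter itself, as in
division by repeated subtraction and in repeated halving. -/
theorem loopc_of_pos {r : Counter} (N : ℕ) (hN : N ≤ B) (I : ℕ → View) (h0 : I 0 = v)
    (h1 : I N = w) (h2 : ∀ i < N, 0 < (I i).cnt r) (h3 : (I N).cnt r = 0)
    (h4 : ∀ i < N, Run B ((I i).set r ((I i).cnt r - 1)) p (I (i + 1))) :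
    Run B v (loopc r p) w := by
  suffices H : ∀ M i, i + M = N → ∀ S, (I i).Describes S →
      ∃ S', loopRel (.cnt r) (p.Exec B) M S S' ∧ (I N).Describes S' by
    intro S hS
    obtain ⟨S', h5, h6⟩ := H N 0 (by omega) S (h0 ▸ hS)
    exact ⟨S', ⟨N, hN, h5⟩, h1 ▸ h6⟩
  intro M
  induction M with
  | zero =>
    intro i hi S hS
    obtain rfl : i = N := by omega
    exact ⟨S, ⟨List.length_eq_zero_iff.1 ((hS.cnt r).trans h3), rfl⟩, hS⟩
  | succ M ih =>
    intro i hi S hS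
    obtain ⟨S₀, h5, h6⟩ := Run.dec (B := B) rfl S hS
    obtain rfl := h5
    obtain ⟨S₁, h7, h8⟩ := h4 i (by omega) _ h6
    obtain ⟨S₂, h9, h10⟩ := ih (i + 1) (by omega) S₁ h8
    refine ⟨S₂, ⟨?_, S₁, h7, h9⟩, h10⟩
    have := h2 i (by omega)
    rw [← hS.cnt r] at this
    exact List.ne_nil_of_length_pos this

theorem loopc {r : Counter} (N : ℕ) (hN : N ≤ B) (I : ℕ → View) (h0 : I 0 = v)
    (h1 : I N = w) (h2 : ∀ i, (I i).cnt r = N - i)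
    (h4 : ∀ i < N, Run B ((I i).set r (N - i - 1)) p (I (i + 1))) :
    Run B v (loopc r p) w :=
  loopc_of_pos N hN I h0 h1 (fun i hi => by rw [h2]; omega) (by rw [h2]; omega)
    (fun i hi => by rw [h2]; exact h4 i hi)

theorem push_query {g : DyadicSymbol} {s : Set (List DyadicSymbol)}
    (hs : ∀ l ∈ v.query, g :: l ∈ s) (h : { v with query := s } = w) :
    Run B v (.push .query g) w := by
  subst h
  refine fun S hS => ⟨_, rfl, ?_, ?_, ?_, ?_⟩
  · simpa using hS.cnt
  · simpa using hs _ hS.query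
  · simpa using hS.aux
  · simpa using hS.out

theorem pop_query {s : Set (List DyadicSymbol)}
    (hs : ∀ l ∈ v.query, l.tail ∈ s) (h : { v with query := s } = w) :
    Run B v (.pop .query) w := by
  subst h
  refine fun S hS => ⟨_, rfl, ?_, ?_, ?_, ?_⟩
  · simpa using hS.cnt
  · simpa using hs _ hS.query
  · simpa using hS.aux
  · simpa using hS.out

/-- The contents of the query stack are known only up to membership in a set, so all its members
must agree on the test. -/
theorem ite_query {c : Option DyadicSymbol → Bool} (b : Bool) (hb : ∀ l ∈ v.query, c l.head? = b)
    (h : b = true → Run B v p w) (h' : b = false → Run B v p' w) :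
    Run B v (.ite .query c p p') w := by
  intro S hS
  have hr := hb _ hS.query
  cases b with
  | false =>
    obtain ⟨S', h1, h2⟩ := h' rfl S hS
    exact ⟨S', Or.inr ⟨hr, h1⟩, h2⟩
  | true =>
    obtain ⟨S', h1, h2⟩ := h rfl S hS
    exact ⟨S', Or.inl ⟨hr, h1⟩, h2⟩

theorem push_aux {g : DyadicSymbol} (h : { v with aux := g :: v.aux } = w) :
    Run B v (.push .aux g) w := by
  subst h
  refine fun S hS => ⟨_, rfl, ?_, ?_, ?_, ?_⟩
  · simpa using hS.cnt
  · simpa using hS.query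
  · simpa using hS.aux
  · simpa using hS.out

theorem pop_aux (h : { v with aux := v.aux.tail } = w) : Run B v (.pop .aux) w := by
  subst h
  refine fun S hS => ⟨_, rfl, ?_, ?_, ?_, ?_⟩
  · simpa using hS.cnt
  · simpa using hS.query
  · simp [hS.aux]
  · simpa using hS.out

theorem ite_aux {c : Option DyadicSymbol → Bool} (h : c v.aux.head? = true → Run B v p w)
    (h' : c v.aux.head? = false → Run B v p' w) : Run B v (.ite .aux c p p') w := by
  intro S hS
  cases e : c v.aux.head? with
  | false =>
    obtain ⟨S', h1, h2⟩ := h' e S hS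
    exact ⟨S', Or.inr ⟨by rw [hS.aux, e], h1⟩, h2⟩
  | true =>
    obtain ⟨S', h1, h2⟩ := h e S hS
    exact ⟨S', Or.inl ⟨by rw [hS.aux, e], h1⟩, h2⟩

theorem push_out {g : DyadicSymbol} (h : { v with out := g :: v.out } = w) :
    Run B v (.push .out g) w := by
  subst h
  refine fun S hS => ⟨_, rfl, ?_, ?_, ?_, ?_⟩
  · simpa using hS.cnt
  · simpa using hS.query
  · simpa using hS.aux
  · simp [hS.out]

end Run

/-! ### Unary arithmetic on counters -/

/-- Do `p` as often as counter `r` says, where `r` is restored by means of `t`. -/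
def forc (r t : Counter) (p : StackProg Stack DyadicSymbol) : StackProg Stack DyadicSymbol :=
  loopc r (inc t ;; p) ;; loopc t (inc r)

namespace Run

variable {B : ℕ} {v w x : View} {p p' : StackProg Stack DyadicSymbol}

theorem move {a b : Counter} (hab : a ≠ b) (h : v.cnt a ≤ B)
    (hw : (v.set a 0).set b (v.cnt b + v.cnt a) = w) : Run B v (_root_.loopc a (_root_.inc b)) w := by
  refine loopc (v.cnt a) h (fun i => (v.set a (v.cnt a - i)).set b (v.cnt b + i)) ?_ ?_ ?_ ?_
  · refine View.ext_cnt (fun s => ?_) rfl rfl rfl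
    simp only [View.cnt_set, Function.update_apply]
    grind
  · rw [← hw]; simp
  · simp [hab]
  · intro i hi
    refine inc ?_
    refine View.ext_cnt (fun s => ?_) rfl rfl rfl
    simp only [View.cnt_set, Function.update_apply]
    grind

theorem move_double {a b : Counter} (hab : a ≠ b) (h : v.cnt a ≤ B)
    (hw : (v.set a 0).set b (v.cnt b + 2 * v.cnt a) = w) :
    Run B v (_root_.loopc a (_root_.inc b ;; _root_.inc b)) w := by
  refine loopc (v.cnt a) h (fun i => (v.set a (v.cnt a - i)).set b (v.cnt b + 2 * i)) ?_ ?_ ?_ ?_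
  · refine View.ext_cnt (fun s => ?_) rfl rfl rfl
    simp only [View.cnt_set, Function.update_apply]
    grind
  · rw [← hw]; simp
  · simp [hab]
  · intro i hi
    refine (inc rfl).seq (inc ?_)
    refine View.ext_cnt (fun s => ?_) rfl rfl rfl
    simp only [View.cnt_set, Function.update_apply]
    grind

theorem clear {a : Counter} (h : v.cnt a ≤ B) (hw : v.set a 0 = w) :
    Run B v (_root_.loopc a .skip) w := by
  refine loopc (v.cnt a) h (fun i => v.set a (v.cnt a - i)) ?_ ?_ ?_ ?_
  · refine View.ext_cnt (fun s => ?_) rfl rfl rfl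
    simp
  · rw [← hw]; simp
  · simp
  · intro i hi
    refine skip ?_
    refine View.ext_cnt (fun s => ?_) rfl rfl rfl
    simp only [View.cnt_set, Function.update_apply]
    grind

/-- Each round moves one unit from `r` to `t`, and at the end all are moved back. The invariant `I`
describes the other stacks; the actual values of `r` and `t` are superimposed on it. -/
theorem forc {r t : Counter} (hrt : r ≠ t) (N : ℕ) (hN : N ≤ B) (hr : v.cnt r = N)
    (ht : v.cnt t = 0) (I : ℕ → View) (h0 : I 0 = v) (h1 : I N = w) (hr' : w.cnt r = N)
    (ht' : w.cnt t = 0)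
    (h : ∀ i < N, Run B (((I i).set r (N - i - 1)).set t (i + 1)) p
      (((I (i + 1)).set r (N - i - 1)).set t (i + 1))) :
    Run B v (forc r t p) w := by
  have h2 : Run B v (_root_.loopc r (_root_.inc t ;; p)) ((w.set r 0).set t N) := by
    refine loopc N hN (fun i => ((I i).set r (N - i)).set t i) ?_ ?_ ?_ ?_
    · refine View.ext_cnt (fun s => ?_) (by simp [h0]) (by simp [h0]) (by simp [h0])
      simp [Function.update_apply, h0]
      split_ifs <;> simp_all
    · simp [h1]
    · simp [hrt]
    · intro i hi
      refine (inc ?_).seq (h i hi)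
      refine View.ext_cnt (fun s => ?_) rfl rfl rfl
      simp [Function.update_apply]
      split_ifs <;> simp_all
  refine h2.seq (move hrt.symm (by simpa using hN) ?_)
  refine View.ext_cnt (fun s => ?_) rfl rfl rfl
  simp [Function.update_apply]
  split_ifs <;> simp_all

theorem sub {r t d : Counter} (hrt : r ≠ t) (hrd : r ≠ d) (htd : t ≠ d) (hr : v.cnt r ≤ B)
    (ht : v.cnt t = 0) (hw : v.set d (v.cnt d - v.cnt r) = w) :
    Run B v (_root_.forc r t (_root_.dec d)) w := by
  subst hw
  refine forc hrt (v.cnt r) hr rfl ht (fun i => v.set d (v.cnt d - i)) ?_ rfl (by simp [hrd])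
    (by simp [htd, ht]) ?_
  · refine View.ext_cnt (fun s => ?_) rfl rfl rfl
    simp
  · intro i hi
    refine dec ?_
    refine View.ext_cnt (fun s => ?_) rfl rfl rfl
    simp only [View.cnt_set, Function.update_apply]
    grind

theorem add {r t d : Counter} (hrt : r ≠ t) (hrd : r ≠ d) (htd : t ≠ d) (hr : v.cnt r ≤ B)
    (ht : v.cnt t = 0) (hw : v.set d (v.cnt d + v.cnt r) = w) :
    Run B v (_root_.forc r t (_root_.inc d)) w := by
  subst hw
  refine forc hrt (v.cnt r) hr rfl ht (fun i => v.set d (v.cnt d + i)) ?_ rfl (by simp [hrd])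
    (by simp [htd, ht]) ?_
  · refine View.ext_cnt (fun s => ?_) rfl rfl rfl
    simp
  · intro i hi
    refine inc ?_
    refine View.ext_cnt (fun s => ?_) rfl rfl rfl
    simp only [View.cnt_set, Function.update_apply]
    grind

theorem move_min {r t d a : Counter} (hrt : r ≠ t) (hrd : r ≠ d) (htd : t ≠ d) (hra : r ≠ a)
    (hta : t ≠ a) (hda : d ≠ a) (hr : v.cnt r ≤ B) (ht : v.cnt t = 0)
    (hw : (v.set d (v.cnt d - v.cnt r)).set a (v.cnt a + min (v.cnt r) (v.cnt d)) = w) :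
    Run B v (_root_.forc r t (_root_.itec d (_root_.dec d ;; _root_.inc a) .skip)) w := by
  subst hw
  refine forc hrt (v.cnt r) hr rfl ht
    (fun i => (v.set d (v.cnt d - i)).set a (v.cnt a + min i (v.cnt d))) ?_ rfl
    (by simp [hrd, hra]) (by simp [htd, hta, ht]) ?_
  · refine View.ext_cnt (fun s => ?_) rfl rfl rfl
    simp only [View.cnt_set, Function.update_apply]
    grind
  · intro i hi
    refine itec (fun h => (dec rfl).seq (inc ?_)) (fun h => skip ?_)
    all_goals
      simp [hda, hrd.symm, htd.symm] at h
      refine View.ext_cnt (fun s => ?_) rfl rfl rfl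
      simp only [View.cnt_set, Function.update_apply]
      grind

end Run

/-- The program that replaces counter `a` by `min U (2 * a - if b then 0 else q)`. -/
def stepProg : Bool → StackProg Stack DyadicSymbol
  | true => loopc .acc (inc .dbl ;; inc .dbl) ;;
      forc .cap .tmp (itec .dbl (dec .dbl ;; inc .acc) .skip) ;; loopc .dbl .skip
  | false => loopc .acc (inc .dbl ;; inc .dbl) ;; forc .den .tmp (dec .dbl) ;;
      forc .cap .tmp (itec .dbl (dec .dbl ;; inc .acc) .skip) ;; loopc .dbl .skip

/-- Truncated subtraction of `den` is the lower clamp; moving back at most `cap` units and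
discarding the rest is the upper one. -/
theorem run_stepProg {B : ℕ} {v w : View} (b : Bool) (hd : v.cnt .dbl = 0) (ht : v.cnt .tmp = 0)
    (ha : 2 * v.cnt .acc ≤ B) (hU : v.cnt .cap ≤ B) (hq : v.cnt .den ≤ B)
    (hw : v.set .acc (min (v.cnt .cap) (2 * v.cnt .acc - if b then 0 else v.cnt .den)) = w) :
    Run B v (stepProg b) w := by
  subst hw
  cases b with
  | true =>
    refine (Run.move_double (by decide) (by omega) rfl).seq
      ((Run.move_min (by decide) (by decide) (by decide) (by decide) (by decide) (by decide)
        (by simpa using hU) (by simpa using ht) rfl).seq (Run.clear ?_ ?_))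
    · simp
      omega
    · refine View.ext_cnt (fun s => ?_) rfl rfl rfl
      cases s <;> simp [hd]
  | false =>
    refine (Run.move_double (by decide) (by omega) rfl).seq
      ((Run.sub (by decide) (by decide) (by decide) (by simpa using hq) (by simpa using ht) rfl).seq
      ((Run.move_min (by decide) (by decide) (by decide) (by decide) (by decide) (by decide)
        (by simpa using hU) (by simpa using ht) rfl).seq (Run.clear ?_ ?_)))
    · simp
      omega
    · refine View.ext_cnt (fun s => ?_) rfl rfl rfl
      cases s <;> simp [hd]

/-! ### Reading digits from the query stack -/

/-- The `i`-th digit in a list of symbols, where everything but a `1` counts as `0`. -/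
def digit (l : List DyadicSymbol) (i : ℕ) : Bool := decide (l[i]? = some (.bit true))

/-- The lists with digits `D`. -/
def withDigits (D : ℕ → Bool) : Set (List DyadicSymbol) := {l | digit l = D}

theorem decide_head?_of_mem_withDigits {D : ℕ → Bool} {l : List DyadicSymbol}
    (h : l ∈ withDigits D) : decide (l.head? = some (.bit true)) = D 0 := by
  obtain rfl : digit l = D := h
  simp [digit, List.head?_eq_getElem?]

theorem tail_mem_withDigits {D : ℕ → Bool} {l : List DyadicSymbol}
    (h : l ∈ withDigits D) : l.tail ∈ withDigits fun j => D (j + 1) := by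
  obtain rfl : digit l = D := h
  funext j
  simp [digit]

theorem cons_mem_withDigits {D E : ℕ → Bool} {l : List DyadicSymbol} (h : l ∈ withDigits D)
    (hE : ∀ j, E (j + 1) = D j) : .bit (E 0) :: l ∈ withDigits E := by
  obtain rfl : digit l = D := h
  funext j
  cases j with
  | zero => simp [digit]
  | succ j => simp [digit, hE]

/-- The contents of the accumulator after reading `j` digits, with initial contents `a`. -/
def accVal (cap den : ℕ) (D : ℕ → Bool) (a : ℕ) : ℕ → ℕ
  | 0 => a
  | j + 1 => min cap (2 * accVal cap den D a j - if D j then 0 else den)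

theorem accVal_le {cap den : ℕ} {D : ℕ → Bool} {a : ℕ} (ha : a ≤ cap) (j : ℕ) :
    accVal cap den D a j ≤ cap := by
  cases j with
  | zero => exact ha
  | succ j => exact min_le_left _ _

/-- Read `len` digits from the query stack, apply `stepProg` for each of them, and put the digits
back. -/
def readProg : StackProg Stack DyadicSymbol :=
  loopc .len (inc .len' ;; .ite .query (fun o => decide (o = some (.bit true)))
    (.pop .query ;; .push .aux (.bit true) ;; stepProg true)
    (.pop .query ;; .push .aux (.bit false) ;; stepProg false)) ;;
  loopc .len' (inc .len ;; .ite .aux (fun o => decide (o = some (.bit true)))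
    (.pop .aux ;; .push .query (.bit true)) (.pop .aux ;; .push .query (.bit false)))

/-- The stacks after reading `i` digits. -/
def readView (v : View) (D : ℕ → Bool) (i : ℕ) : View where
  cnt := Function.update (Function.update v.cnt .len (v.cnt .len - i)) .len' i
  query := withDigits fun j => D (j + i)
  aux := ((List.range i).map fun j => .bit (D j)).reverse
  out := v.out

/-- The digits are restored because every pair p, q reads them again. If the list is shorter than
`len`, popping has no effect and explicit zeros are put back. Hence only the digit function is
preserved, not the list, which is why `withDigits` is used. -/
theorem run_readProg {B : ℕ} {v w : View} (D : ℕ → Bool) (hd : v.cnt .dbl = 0)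
    (ht : v.cnt .tmp = 0) (hl : v.cnt .len' = 0) (hv : v.aux = []) (hD : v.query = withDigits D)
    (ha : v.cnt .acc ≤ v.cnt .cap) (hU : 2 * v.cnt .cap ≤ B) (hq : v.cnt .den ≤ B)
    (hL : v.cnt .len ≤ B)
    (hw : v.set .acc (accVal (v.cnt .cap) (v.cnt .den) D (v.cnt .acc) (v.cnt .len)) = w) :
    Run B v readProg w := by
  set f := accVal (v.cnt .cap) (v.cnt .den) D (v.cnt .acc) with hf
  refine Run.seq (w := readView (v.set .acc (f (v.cnt .len))) D (v.cnt .len)) ?_ ?_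
  · refine Run.loopc (v.cnt .len) hL (fun i => readView (v.set .acc (f i)) D i) ?_ rfl
      (by simp [readView]) ?_
    · refine View.ext_cnt (fun s => ?_) (by simp [readView, hD]) (by simp [readView, hv])
        (by simp [readView])
      cases s <;> simp [readView, hf, accVal, hl]
    · intro i hi
      refine (Run.inc rfl).seq (Run.ite_query (D i) ?_ ?_ ?_)
      · intro l hl
        simpa using decide_head?_of_mem_withDigits hl
      all_goals
        intro hb
        refine (Run.pop_query (fun l hl => tail_mem_withDigits hl) rfl).seq
          ((Run.push_aux rfl).seq (run_stepProg _ ?_ ?_ ?_ ?_ ?_ ?_))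
        · simp [readView, hd]
        · simp [readView, ht]
        · have : f i ≤ v.cnt .cap := accVal_le ha i
          simp [readView]
          omega
        · simp [readView]
          omega
        · simpa [readView] using hq
        · refine View.ext_cnt (fun s => ?_) (by simp [readView, add_assoc, add_comm 1])
            (by simp [readView, List.range_succ, hb]) (by simp [readView])
          cases s <;> simp [readView, hf, accVal, hb, Nat.sub_sub]
  -- Putting the digits back passes through the same reading positions in reverse order, with the
  -- accumulator now fixed.
  · refine Run.loopc (v.cnt .len) hL
      (fun i => readView (v.set .acc (f (v.cnt .len))) D (v.cnt .len - i)) (by simp) ?_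
      (by simp [readView]) ?_
    · rw [← hw]
      refine View.ext_cnt (fun s => ?_) (by simp [readView, hD]) (by simp [readView, hv])
        (by simp [readView])
      cases s <;> simp [readView, hl]
    · intro i hi
      obtain ⟨j, hj⟩ : ∃ j, v.cnt .len - i = j + 1 := ⟨v.cnt .len - i - 1, by omega⟩
      have hj' : v.cnt .len - (i + 1) = j := by omega
      refine (Run.inc rfl).seq (Run.ite_aux ?_ ?_)
      all_goals
        intro hb
        have hb' := hb
        simp [readView, hj, List.range_succ] at hb'
        refine (Run.pop_aux rfl).seq (Run.push_query (s := withDigits fun m => D (m + j)) ?_ ?_)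
        · intro l hl
          have := cons_mem_withDigits (E := fun m => D (m + j)) hl
            (fun m => by simp [hj, add_assoc, add_comm 1])
          simpa [hb'] using this
        · refine View.ext_cnt (fun s => ?_) (by simp [readView, hj'])
            (by simp [readView, hj', hj, List.range_succ]) (by simp [readView])
          cases s <;> simp [readView, hj, hj'] <;> omega

/-! ### The sums -/

/-- The value computed for `2 ^ prec * den * alpha den x`. -/
def sumVal (cap den : ℕ) (D : ℕ → Bool) (len : ℕ) : ℕ :=
  ∑ i ∈ Finset.range den, (accVal cap den D (i + 1) len - den)

/-- The program that computes `sumVal`. -/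
def sumProg : StackProg Stack DyadicSymbol :=
  loopc .idx (inc .idx' ;; forc .idx' .tmp (inc .acc) ;; readProg ;; forc .den .tmp (dec .acc) ;;
    loopc .acc (inc .sum)) ;;
  loopc .idx' (inc .idx)

/-- The counter `idx'` runs through 1, ..., `den`, which are the start values `den - p`. Subtracting
`den` after reading removes the offset and cuts negative values off at 0. -/
theorem run_sumProg {B : ℕ} {v w : View} (D : ℕ → Bool) (hd : v.cnt .dbl = 0)
    (ht : v.cnt .tmp = 0) (hl : v.cnt .len' = 0) (he : v.cnt .idx' = 0) (hac : v.cnt .acc = 0)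
    (hs : v.cnt .sum = 0) (hi : v.cnt .idx = v.cnt .den)
    (hv : v.aux = []) (hD : v.query = withDigits D)
    (ha : v.cnt .den ≤ v.cnt .cap) (hU : 2 * v.cnt .cap ≤ B) (hL : v.cnt .len ≤ B)
    (hw : v.set .sum (sumVal (v.cnt .cap) (v.cnt .den) D (v.cnt .len)) = w) :
    Run B v sumProg w := by
  subst hw
  set f : ℕ → ℕ := fun m => ∑ i ∈ Finset.range m,
    (accVal (v.cnt .cap) (v.cnt .den) D (i + 1) (v.cnt .len) - v.cnt .den) with hf
  refine Run.seq (w := ((v.set .sum (f (v.cnt .den))).set .idx 0).set .idx' (v.cnt .den)) ?_ ?_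
  · refine Run.loopc (v.cnt .den) (by omega) (fun i => ((v.set .sum (f i)).set .idx
      (v.cnt .den - i)).set .idx' i) ?_ (by simp) (by simp) ?_
    · refine View.ext_cnt (fun s => ?_) rfl rfl rfl
      cases s <;> simp [hf, hs, hi, he]
    · intro i hi
      have h1 := accVal_le (D := D) (den := v.cnt .den) (show i + 1 ≤ v.cnt .cap by omega)
        (v.cnt .len)
      refine (Run.inc rfl).seq ((Run.add (by decide) (by decide) (by decide) ?_ ?_ rfl).seq
        ((run_readProg D ?_ ?_ ?_ ?_ ?_ ?_ ?_ ?_ ?_ rfl).seq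
        ((Run.sub (by decide) (by decide) (by decide) ?_ ?_ rfl).seq
        (Run.move (by decide) ?_ ?_))))
      case refine_15 =>
        refine View.ext_cnt (fun s => ?_) rfl rfl rfl
        cases s <;> simp [hf, hac, Finset.sum_range_succ, Nat.sub_sub]
      all_goals simp [hd, ht, hl, hv, hD, hac]
      all_goals omega
  · refine Run.move (by decide) ?_ ?_
    · simp
      omega
    · refine View.ext_cnt (fun s => ?_) rfl rfl rfl
      cases s <;> simp [hf, sumVal, hi, he]

/-- `G / (p + 1)`, rounded up. -/
def ceilDiv' (p G : ℕ) : ℕ := (G + p) / (p + 1)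

theorem ceilDiv'_le (p G : ℕ) : ceilDiv' p G ≤ G := by
  rcases Nat.eq_zero_or_pos G with rfl | h
  · simp [ceilDiv']
  · rw [ceilDiv', ← Nat.lt_succ_iff, Nat.div_lt_iff_lt_mul (by omega)]
    have : p * 1 ≤ p * G := Nat.mul_le_mul_left _ h
    rw [Nat.succ_mul, Nat.mul_add]
    nlinarith

/-- Add to counter `r` the value of counter `s` divided by `pred + 1`, rounded up. -/
def divProg (s r : Counter) : StackProg Stack DyadicSymbol :=
  loopc s (forc .pred .tmp (dec s) ;; inc r)

theorem run_divProg {B : ℕ} {v w : View} {s r : Counter} (hsr : s ≠ r) (hs : s ≠ .pred)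
    (hs' : s ≠ .tmp) (hr : r ≠ .pred) (hr' : r ≠ .tmp) (ht : v.cnt .tmp = 0)
    (hp : v.cnt .pred ≤ B) (hB : v.cnt s ≤ B)
    (hw : (v.set s 0).set r (v.cnt r + ceilDiv' (v.cnt .pred) (v.cnt s)) = w) :
    Run B v (divProg s r) w := by
  -- A round removes `pred + 1` units, one by the loop test and `pred` by the body. Round i takes
  -- place exactly if something is left, so an incomplete last round counts: the quotient is rounded
  -- up.
  have key : ∀ i, i < ceilDiv' (v.cnt .pred) (v.cnt s) ↔ i * (v.cnt .pred + 1) < v.cnt s := by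
    intro i
    rw [ceilDiv', ← Nat.succ_le_iff, Nat.le_div_iff_mul_le (by omega), Nat.succ_mul]
    omega
  refine Run.loopc_of_pos (ceilDiv' (v.cnt .pred) (v.cnt s)) ((ceilDiv'_le _ _).trans hB)
    (fun i => (v.set s (v.cnt s - i * (v.cnt .pred + 1))).set r (v.cnt r + i)) ?_ ?_ ?_ ?_ ?_
  · refine View.ext_cnt (fun s => ?_) rfl rfl rfl
    simp
  · rw [← hw]
    have := (key (ceilDiv' (v.cnt .pred) (v.cnt s))).not.1 (lt_irrefl _)
    have h2 : v.cnt s - ceilDiv' (v.cnt .pred) (v.cnt s) * (v.cnt .pred + 1) = 0 := by omega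
    simp only [h2]
  · intro i hi
    have := (key i).1 hi
    simp [hsr]
    omega
  · have := (key (ceilDiv' (v.cnt .pred) (v.cnt s))).not.1 (lt_irrefl _)
    simp [hsr]
    omega
  · intro i hi
    refine (Run.sub (by decide) hs.symm hs'.symm ?_ ?_ rfl).seq (Run.inc ?_)
    · simpa [hs.symm, hr.symm] using hp
    · simpa [hs'.symm, hr'.symm] using ht
    · refine View.ext_cnt (fun u => ?_) rfl rfl rfl
      have : v.cnt s - i * (v.cnt .pred + 1) - 1 - v.cnt .pred =
        v.cnt s - (i + 1) * (v.cnt .pred + 1) := by rw [Nat.succ_mul]; omega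
      simp only [View.cnt_set, Function.update_apply]
      grind

/-- The value computed for `2 ^ prec * alpha (j + 1) x / (j + 1) ^ 2`. -/
def termVal (cap₀ prec : ℕ) (D : ℕ → Bool) (j : ℕ) : ℕ :=
  ceilDiv' j (ceilDiv' j (ceilDiv' j (sumVal (cap₀ + (j + 1)) (j + 1) D (prec + (j + 1)))))

theorem sumVal_le {c den : ℕ} {D : ℕ → Bool} {len : ℕ} : sumVal (c + den) den D len ≤ den * c := by
  refine (Finset.sum_le_card_nsmul _ _ c fun i hi => ?_).trans (by simp)
  have := accVal_le (D := D) (den := den) (cap := c + den) (a := i + 1)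
    (by have := Finset.mem_range.1 hi; omega) len
  omega

theorem termVal_le {c k : ℕ} {D : ℕ → Bool} {j : ℕ} : termVal c k D j ≤ (j + 1) * c :=
  (ceilDiv'_le _ _).trans ((ceilDiv'_le _ _).trans ((ceilDiv'_le _ _).trans sumVal_le))

/-- The value computed for `2 ^ prec * F x`, with `N` terms of the series. -/
def totalVal (cap₀ prec : ℕ) (D : ℕ → Bool) (N : ℕ) : ℕ :=
  ∑ j ∈ Finset.range N, termVal cap₀ prec D j

theorem totalVal_le {c k : ℕ} {D : ℕ → Bool} {N : ℕ} : totalVal c k D N ≤ N * (N * c) := by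
  refine (Finset.sum_le_card_nsmul _ _ (N * c) fun i hi => termVal_le.trans ?_).trans (by simp)
  exact Nat.mul_le_mul_right _ (Finset.mem_range.1 hi)

/-- The program that computes `totalVal`. -/
def totalProg : StackProg Stack DyadicSymbol :=
  loopc .left (inc .den ;; inc .idx ;; inc .cap ;; inc .len ;; sumProg ;;
    divProg .sum .acc ;; loopc .acc (inc .sum) ;; divProg .sum .acc ;; loopc .acc (inc .sum) ;;
    divProg .sum .total ;; inc .pred)

/-- The stacks after computing `i` of `N` terms. -/
def totalView (v : View) (D : ℕ → Bool) (N i : ℕ) : View :=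
  ((((((v.set .left (N - i)).set .den i).set .idx i).set .cap (v.cnt .cap + i)).set .len
    (v.cnt .len + i)).set .pred i).set .total (totalVal (v.cnt .cap) (v.cnt .len) D i)

/-- Of the three divisions by q, one removes the factor q in `sumVal` and two give the weight 1/q².
Both `cap` and `len` grow with q, as the offset of the accumulator and the number of digits needed
do. -/
theorem run_totalProg {B N c k : ℕ} {v w : View} (D : ℕ → Bool) (hd : v.cnt .dbl = 0)
    (ht : v.cnt .tmp = 0) (hl : v.cnt .len' = 0) (he : v.cnt .idx' = 0) (hac : v.cnt .acc = 0)
    (hs : v.cnt .sum = 0) (hi : v.cnt .idx = 0) (hden : v.cnt .den = 0) (hpred : v.cnt .pred = 0)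
    (htot : v.cnt .total = 0) (hleft : v.cnt .left = N)
    (hv : v.aux = []) (hD : v.query = withDigits D) (hc : v.cnt .cap = c) (hk : v.cnt .len = k)
    (hU : 2 * (c + N) ≤ B) (hL : k + N ≤ B) (hB : N * c ≤ B)
    (hw : totalView v D N N = w) :
    Run B v totalProg w := by
  refine Run.loopc N (by omega) (totalView v D N) ?_ hw (by simp [totalView]) ?_
  · refine View.ext_cnt (fun s => ?_) rfl rfl rfl
    cases s <;> simp [totalView, totalVal, hl, he, hs, hi, hden, hpred, htot, hleft]
  · intro i hi
    have h0 : (i + 1) * c ≤ B := (Nat.mul_le_mul_right _ hi).trans hB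
    have h1 := (sumVal_le (c := c) (den := i + 1) (D := D) (len := k + (i + 1))).trans h0
    have h2 := (ceilDiv'_le i _).trans h1
    have h3 := (ceilDiv'_le i _).trans h2
    refine (Run.inc rfl).seq ((Run.inc rfl).seq ((Run.inc rfl).seq ((Run.inc rfl).seq
      ((run_sumProg D ?_ ?_ ?_ ?_ ?_ ?_ ?_ ?_ ?_ ?_ ?_ ?_ rfl).seq
      ((run_divProg (by decide) (by decide) (by decide) (by decide) (by decide) ?_ ?_ ?_ rfl).seq
      ((Run.move (by decide) ?_ rfl).seq
      ((run_divProg (by decide) (by decide) (by decide) (by decide) (by decide) ?_ ?_ ?_ rfl).seq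
      ((Run.move (by decide) ?_ rfl).seq
      ((run_divProg (by decide) (by decide) (by decide) (by decide) (by decide) ?_ ?_ ?_ rfl).seq
      (Run.inc ?_))))))))))
    case refine_24 =>
      refine View.ext_cnt (fun s => ?_) rfl rfl rfl
      cases s <;> simp [totalView, totalVal, Finset.sum_range_succ, termVal, Nat.sub_sub, hac, hs,
        add_assoc]
    all_goals simp [totalView, hd, ht, hl, he, hac, hs, hv, hD, hc, hk]
    all_goals omega

/-! ### Preparation of the query -/

/-- Double a counter. -/
def doubleProg (r : Counter) : StackProg Stack DyadicSymbol :=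
  loopc r (inc .tmp ;; inc .tmp) ;; loopc .tmp (inc r)

theorem run_doubleProg {B : ℕ} {v w : View} {r : Counter} (hr : r ≠ .tmp) (ht : v.cnt .tmp = 0)
    (hB : 2 * v.cnt r ≤ B) (hw : v.set r (2 * v.cnt r) = w) : Run B v (doubleProg r) w := by
  refine (Run.move_double hr (by omega) rfl).seq (Run.move hr.symm ?_ ?_)
  · simpa [ht] using hB
  · rw [← hw]
    refine View.ext_cnt (fun s => ?_) rfl rfl rfl
    simp only [View.cnt_set, Function.update_apply]
    grind

/-- Push `left + prec` symbols `1` on the query stack. -/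
def pushOnesProg : StackProg Stack DyadicSymbol :=
  forc .left .tmp (.push .query (.bit true)) ;; forc .prec .tmp (.push .query (.bit true))

theorem run_pushOnes_forc {B : ℕ} {v w : View} {l : List DyadicSymbol} {r : Counter}
    (hr : r ≠ .tmp) (ht : v.cnt .tmp = 0) (hB : v.cnt r ≤ B) (hv : v.query = {l})
    (hw : { v with query := {List.replicate (v.cnt r) (.bit true) ++ l} } = w) :
    Run B v (forc r .tmp (.push .query (.bit true))) w := by
  subst hw
  refine Run.forc hr (v.cnt r) hB rfl ht
    (fun i => { v with query := {List.replicate i (.bit true) ++ l} }) ?_ rfl rfl ht ?_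
  · simp [← hv]
  · intro i hi
    refine Run.push_query ?_ rfl
    rintro m (rfl : m = _)
    simp [List.replicate_succ]

theorem run_pushOnesProg {B : ℕ} {v w : View} {l : List DyadicSymbol}
    (ht : v.cnt .tmp = 0) (hl : v.cnt .left ≤ B) (hp : v.cnt .prec ≤ B) (hv : v.query = {l})
    (hw : { v with query :=
      {List.replicate (v.cnt .left + v.cnt .prec) (.bit true) ++ l} } = w) :
    Run B v pushOnesProg w := by
  refine (run_pushOnes_forc (by decide) ht hl hv rfl).seq
    (run_pushOnes_forc (by decide) ht hp rfl ?_)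
  rw [← hw]
  simp only [← List.append_assoc, List.replicate_append_replicate, add_comm (v.cnt .left)]

/-- The program before the query. -/
def setupProg : StackProg Stack DyadicSymbol :=
  inc .arg ;; inc .arg ;; inc .arg ;; inc .left ;; inc .cap ;;
  loopc .arg (inc .prec ;; inc .prec ;; inc .len ;; inc .len ;; doubleProg .left ;;
    doubleProg .cap ;; doubleProg .cap) ;;
  pushOnesProg

/-- The stacks at the start on input `n`. -/
def initView (n : ℕ) : View := ⟨Function.update 0 .arg n, {[]}, [], []⟩

/-- The stacks before the query, without the contents of the query stack. -/
def setupView (n i : ℕ) (s : Set (List DyadicSymbol)) : View where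
  cnt
    | .arg => n - i
    | .left => 2 ^ i
    | .cap => 4 ^ i
    | .len => 2 * i
    | .prec => 2 * i
    | _ => 0
  query := s
  aux := []
  out := []

/-- Doubling `left` once and `cap` twice per round keeps `cap = 2 ^ prec`. The ones pushed on the
query stack form the argument of the query. -/
theorem run_setupProg {B n : ℕ} (hB : 4 ^ (n + 3) ≤ B) :
    Run B (initView n) setupProg (setupView (n + 3) (n + 3)
      {List.replicate (2 ^ (n + 3) + 2 * (n + 3)) (.bit true)}) := by
  have h2 : ∀ i, 2 ^ i ≤ 4 ^ i := fun i => Nat.pow_le_pow_left (by norm_num) i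
  have h3 : ∀ i, 2 * i ≤ 4 ^ i := by
    intro i
    induction i with
    | zero => simp
    | succ i ih => rw [pow_succ]; have := Nat.one_le_pow i 4 (by norm_num); omega
  have h4 : ∀ i < n + 3, 4 ^ (i + 1) ≤ B := fun i hi =>
    (Nat.pow_le_pow_right (by norm_num) hi).trans hB
  refine (Run.inc rfl).seq ((Run.inc rfl).seq ((Run.inc rfl).seq ((Run.inc rfl).seq
    ((Run.inc rfl).seq (Run.seq (w := setupView (n + 3) (n + 3) {[]}) ?_ ?_)))))
  · refine Run.loopc (n + 3) (by have := h3 (n + 3); omega)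
      (fun i => setupView (n + 3) i {[]}) ?_ rfl (fun i => rfl) ?_
    · refine View.ext_cnt (fun s => ?_) rfl rfl rfl
      cases s <;> simp [setupView, initView]
    · intro i hi
      have h5 := h4 i hi
      have h6 := h2 (i + 1)
      rw [pow_succ] at h5 h6
      refine (Run.inc rfl).seq ((Run.inc rfl).seq ((Run.inc rfl).seq ((Run.inc rfl).seq
        ((run_doubleProg (by decide) ?_ ?_ rfl).seq
        ((run_doubleProg (by decide) ?_ ?_ rfl).seq (run_doubleProg (by decide) ?_ ?_ ?_))))))
      case refine_7 =>
        refine View.ext_cnt (fun s => ?_) rfl rfl rfl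
        cases s <;> simp [setupView] <;> omega
      all_goals simp [setupView]
      all_goals omega
  · refine run_pushOnesProg rfl ((h2 _).trans hB) ((h3 _).trans hB) rfl ?_
    refine View.ext_cnt (fun s => rfl) ?_ rfl rfl
    simp [setupView]

/-! ### Preparation of the digits -/

/-- The part of the answer of the oracle after the sign. -/
def dropSign (l : List DyadicSymbol) : List DyadicSymbol :=
  if l.head? = some .minus then l.tail else l

/-- The digits after the point. If there are digits before the point, `m` ones are used instead. -/
def fracDigits (m : ℕ) (l : List DyadicSymbol) : List DyadicSymbol :=
  if (dropSign l).head? = some .point then (dropSign l).tail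
  else List.replicate m (.bit true) ++ dropSign l

/-- The program that replaces the answer of the oracle by `fracDigits`. -/
def fracProg : StackProg Stack DyadicSymbol :=
  .ite .query (fun o => decide (o = some .minus)) (.pop .query) .skip ;;
  .ite .query (fun o => decide (o = some .point)) (.pop .query) pushOnesProg

theorem run_fracProg {B : ℕ} {v w : View} {l : List DyadicSymbol}
    (ht : v.cnt .tmp = 0) (hl : v.cnt .left ≤ B) (hp : v.cnt .prec ≤ B) (hv : v.query = {l})
    (hw : { v with query := {fracDigits (v.cnt .left + v.cnt .prec) l} } = w) :
    Run B v fracProg w := by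
  subst hw
  refine Run.seq (w := { v with query := {dropSign l} }) ?_ ?_
  · refine Run.ite_query (decide (l.head? = some .minus)) (by simp [hv]) ?_ ?_
    · intro h
      refine Run.pop_query ?_ rfl
      rw [hv]
      rintro m (rfl : m = l)
      simp only [decide_eq_true_eq] at h
      simp [dropSign, h]
    · intro h
      refine Run.skip ?_
      simp only [decide_eq_false_iff_not] at h
      simp [dropSign, h, ← hv]
  · refine Run.ite_query (decide ((dropSign l).head? = some .point)) (by simp) ?_ ?_
    · intro h
      refine Run.pop_query ?_ rfl
      rintro m (rfl : m = _)
      simp only [decide_eq_true_eq] at h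
      simp [fracDigits, h]
    · intro h
      simp only [decide_eq_false_iff_not] at h
      exact run_pushOnesProg ht hl hp rfl (by simp [fracDigits, h])

/-- Serves to pass from the exact answer of the oracle to its class of lists with the same digits.
-/
theorem Run.weaken_query {B : ℕ} {v w : View} {p : StackProg Stack DyadicSymbol}
    {s : Set (List DyadicSymbol)} (h : Run B v p w) (hs : w.query ⊆ s) :
    Run B v p { w with query := s } := by
  intro S hS
  obtain ⟨S', h1, h2⟩ := h S hS
  exact ⟨S', h1, h2.cnt, hs h2.query, h2.aux, h2.out⟩

/-! ### Output -/

/-- Halve counter `total`, and output the remainder. -/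
def halveProg : StackProg Stack DyadicSymbol :=
  loopc .total (itec .par (dec .par ;; inc .dbl) (inc .par)) ;;
  itec .par (dec .par ;; .push .out (.bit true)) (.push .out (.bit false)) ;;
  loopc .dbl (inc .total)

theorem run_halveProg {B : ℕ} {v w : View} (hd : v.cnt .dbl = 0) (hp : v.cnt .par = 0)
    (hB : v.cnt .total ≤ B)
    (hw : { v.set .total (v.cnt .total / 2) with
      out := .bit ((v.cnt .total).testBit 0) :: v.out } = w) : Run B v halveProg w := by
  subst hw
  refine Run.seq (w := ((v.set .total 0).set .dbl (v.cnt .total / 2)).set .par (v.cnt .total % 2))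
    ?_ ((Run.itec (w := { (v.set .total 0).set .dbl (v.cnt .total / 2) with
      out := .bit ((v.cnt .total).testBit 0) :: v.out }) ?_ ?_).seq (Run.move (by decide) ?_ ?_))
  -- After i units, `par` holds the parity of i and `dbl` the half of i.
  · refine Run.loopc (v.cnt .total) hB (fun i => ((v.set .total (v.cnt .total - i)).set .dbl
      (i / 2)).set .par (i % 2)) ?_ (by simp) (by simp) ?_
    · refine View.ext_cnt (fun s => ?_) rfl rfl rfl
      cases s <;> simp [hd, hp]
    · intro i hi
      refine Run.itec (fun h => (Run.dec rfl).seq (Run.inc ?_)) (fun h => Run.inc ?_)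
      all_goals
        simp at h
        refine View.ext_cnt (fun s => ?_) rfl rfl rfl
        cases s <;> simp <;> omega
  · intro h
    simp at h
    have h' : v.cnt .total % 2 = 1 := by omega
    refine (Run.dec rfl).seq (Run.push_out (View.ext_cnt (fun s => ?_) rfl rfl ?_))
    · cases s <;> simp [h', hp]
    · simp [h']
  · intro h
    simp at h
    refine Run.push_out (View.ext_cnt (fun s => ?_) rfl rfl ?_)
    · cases s <;> simp [h, hp]
    · simp [h]
  · simp
    omega
  · refine View.ext_cnt (fun s => ?_) rfl rfl rfl
    cases s <;> simp [hd]

/-- The lowest `k` bits of `m`, the highest one first. -/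
def lowBits (m k : ℕ) : List DyadicSymbol := (List.range k).reverse.map fun i => .bit (m.testBit i)

theorem lowBits_succ (m k : ℕ) : lowBits m (k + 1) = .bit (m.testBit k) :: lowBits m k := by
  simp [lowBits, List.range_succ]

/-- Output `total / 2 ^ prec`, with an additional digit `1` at the end. -/
def outProg : StackProg Stack DyadicSymbol :=
  .push .out (.bit true) ;; loopc .prec halveProg ;; .push .out .point ;;
    loopc .total (inc .total ;; halveProg)

/-- The output stack is filled from its last symbol, so the low bits come first. Halving the integer
part until it is 0 produces no leading zeros, and the final digit 1 excludes trailing zeros. -/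
theorem run_outProg {B k T : ℕ} {v w : View} (hd : v.cnt .dbl = 0) (hp : v.cnt .par = 0)
    (hk : v.cnt .prec = k) (hT : v.cnt .total = T) (hB : T ≤ B) (hkB : k ≤ B) (ho : v.out = [])
    (hw : { (v.set .total 0).set .prec 0 with out := lowBits (T / 2 ^ k) (T / 2 ^ k).size ++
      .point :: (lowBits T k ++ [.bit true]) } = w) : Run B v outProg w := by
  subst hw
  have hdiv : ∀ m, T / m ≤ B := fun m => (Nat.div_le_self _ _).trans hB
  refine (Run.push_out rfl).seq (Run.seq (w := { (v.set .total (T / 2 ^ k)).set .prec 0 with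
    out := lowBits T k ++ [.bit true] }) ?_ ((Run.push_out rfl).seq ?_))
  · refine Run.loopc k hkB (fun i => { (v.set .total (T / 2 ^ i)).set .prec (k - i) with
      out := lowBits T i ++ [.bit true] }) ?_ (by simp) (by simp) ?_
    · refine View.ext_cnt (fun s => ?_) rfl rfl (by simp [lowBits, ho])
      cases s <;> simp [hk, hT]
    · intro i hi
      refine run_halveProg (by simp [hd]) (by simp [hp]) (by simpa using hdiv _)
        (View.ext_cnt (fun s => ?_) rfl rfl ?_)
      · cases s <;> simp [Nat.div_div_eq_div_mul, pow_succ, Nat.sub_sub]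
      · simp [lowBits_succ, Nat.testBit_eq_decide_div_mod_eq]
  · refine Run.loopc_of_pos (T / 2 ^ k).size ?_ (fun i =>
      { (v.set .total (T / 2 ^ k / 2 ^ i)).set .prec 0 with
        out := lowBits (T / 2 ^ k) i ++ .point :: (lowBits T k ++ [.bit true]) }) ?_ ?_ ?_ ?_ ?_
    · exact (Nat.size_le.2 Nat.lt_two_pow_self).trans (hdiv _)
    · refine View.ext_cnt (fun s => ?_) rfl rfl (by simp [lowBits])
      cases s <;> simp
    · refine View.ext_cnt (fun s => ?_) rfl rfl rfl
      cases s <;> simp [Nat.div_eq_of_lt, Nat.lt_size_self]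
    · intro i hi
      have := Nat.lt_size.1 hi
      simpa using Nat.div_pos this (by positivity)
    · simp [Nat.div_eq_of_lt, Nat.lt_size_self]
    · intro i hi
      have h1 := Nat.lt_size.1 hi
      have h2 := Nat.div_pos h1 (show 0 < 2 ^ i by positivity)
      have h3 : T / 2 ^ k / 2 ^ i - 1 + 1 = T / 2 ^ k / 2 ^ i := by omega
      -- The loop test has consumed a unit of `total`, which must be restored before halving.
      refine (Run.inc rfl).seq (run_halveProg (by simp [hd]) (by simp [hp]) ?_
        (View.ext_cnt (fun s => ?_) rfl rfl ?_))
      · simpa [h3] using (Nat.div_le_self _ _).trans (hdiv _)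
      · cases s <;> simp [h3]
        simp [Nat.div_div_eq_div_mul, pow_succ, mul_assoc]
      · simp [lowBits_succ, h3, Nat.testBit_eq_decide_div_mod_eq]

theorem bits_reverse_map (m : ℕ) : (Nat.bits m).reverse.map DyadicSymbol.bit =
    lowBits m m.size := by
  have h : Nat.bits m = (List.range m.size).map m.testBit := by
    refine List.ext_getElem (by simp [Nat.size_eq_bits_len]) fun i h1 h2 => ?_
    simp [Nat.testBit_eq_inth, List.getI_eq_getElem, h1]
  simp [h, lowBits, List.map_reverse, Function.comp_def]

/-! ### Binary expansions -/

namespace Dyadic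

theorem toRat_ofOdd_two_mul_add_one (T k : ℕ) (h : (2 * (T : ℤ) + 1) % 2 = 1) :
    (ofOdd (2 * (T : ℤ) + 1) ((k + 1 : ℕ) : ℤ) h).toRat =
      ((2 * T + 1 : ℤ) : ℚ) / ((2 ^ (k + 1) : ℤ) : ℚ) := by
  rw [toRat_ofOdd_eq_mul_two_pow, zpow_neg, zpow_natCast]
  push_cast
  rw [div_eq_mul_inv]

/-- The numerator is odd, so the fraction is reduced and has exactly k + 1 fractional digits, the
last being 1. -/
theorem expansion_ofOdd (T k : ℕ) (h : (2 * (T : ℤ) + 1) % 2 = 1) :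
    (ofOdd (2 * (T : ℤ) + 1) ((k + 1 : ℕ) : ℤ) h).expansion =
      lowBits (T / 2 ^ k) (T / 2 ^ k).size ++ .point :: (lowBits T k ++ [.bit true]) := by
  have hr := toRat_ofOdd_two_mul_add_one T k h
  have hc : Nat.Coprime (2 * (T : ℤ) + 1).natAbs ((2 : ℤ) ^ (k + 1)).natAbs := by
    rw [Int.natAbs_pow]
    refine Nat.Coprime.pow_right _ ?_
    change Nat.Coprime _ 2
    rw [Nat.coprime_two_right, Int.natAbs_odd, Int.odd_iff]
    exact h
  have hnum : (ofOdd (2 * (T : ℤ) + 1) ((k + 1 : ℕ) : ℤ) h).toRat.num.natAbs = 2 * T + 1 := by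
    rw [hr, Rat.num_div_eq_of_coprime (by positivity) hc]
    omega
  have hden : (ofOdd (2 * (T : ℤ) + 1) ((k + 1 : ℕ) : ℤ) h).toRat.den = 2 ^ (k + 1) := by
    have := Rat.den_div_eq_of_coprime (by positivity) hc
    rw [← hr] at this
    exact_mod_cast this
  have hpos : ¬ (ofOdd (2 * (T : ℤ) + 1) ((k + 1 : ℕ) : ℤ) h).toRat < 0 := by
    rw [hr, not_lt]
    positivity
  have hdiv : (2 * T + 1) / 2 ^ (k + 1) = T / 2 ^ k := by
    rw [pow_succ', ← Nat.div_div_eq_div_mul]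
    congr 1
    omega
  have hbits : (List.range (k + 1)).reverse.map
      (fun i => DyadicSymbol.bit ((2 * T + 1).testBit i)) = lowBits T k ++ [.bit true] := by
    rw [List.range_succ_eq_map]
    simp [lowBits, Nat.testBit_add_one, Function.comp_def, List.map_reverse]
    intro a ha
    congr 1
    omega
  unfold expansion
  simp only [hnum, hden, hpos, Nat.log_pow (le_refl 2), hdiv, hbits, bits_reverse_map, if_false]
  simp

theorem den_toRat_eq_two_pow (d : Dyadic) : d.toRat.den = 2 ^ Nat.log 2 d.toRat.den := by
  suffices h : ∃ K, d.toRat.den = 2 ^ K by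
    obtain ⟨K, hK⟩ := h
    rw [hK, Nat.log_pow (le_refl 2)]
  cases d with
  | zero => exact ⟨0, rfl⟩
  | ofOdd n k hn =>
    rw [toRat_ofOdd_eq_mul_two_pow]
    obtain ⟨j, rfl | rfl⟩ := k.eq_nat_or_neg
    · have h : ((n : ℚ) * 2 ^ (-(j : ℤ))) = Rat.divInt n ((2 ^ j : ℕ) : ℤ) := by
        rw [zpow_neg, zpow_natCast, Rat.divInt_eq_div, div_eq_mul_inv]
        push_cast
        rfl
      rw [h]
      have h2 := Rat.den_dvd n ((2 ^ j : ℕ) : ℤ)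
      obtain ⟨K, -, hK⟩ := (Nat.dvd_prime_pow Nat.prime_two).1 (Int.natCast_dvd_natCast.1 h2)
      exact ⟨K, hK⟩
    · refine ⟨0, ?_⟩
      have h : ((n : ℚ) * 2 ^ (-(-(j : ℤ)))) = ((n * 2 ^ j : ℤ) : ℚ) := by
        rw [neg_neg, zpow_natCast]
        push_cast
        rfl
      rw [h, Rat.den_intCast, pow_zero]

theorem abs_toRat (d : Dyadic) :
    |(d.toRat : ℝ)| = d.toRat.num.natAbs / 2 ^ Nat.log 2 d.toRat.den := by
  have h := d.den_toRat_eq_two_pow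
  have h2 : ((d.toRat.den : ℕ) : ℝ) = 2 ^ Nat.log 2 d.toRat.den := by
    exact_mod_cast congrArg (Nat.cast : ℕ → ℝ) h
  rw [← h2, Rat.cast_def, abs_div, Nat.abs_cast, Nat.cast_natAbs, Int.cast_abs]

theorem dropSign_expansion (d : Dyadic) : dropSign d.expansion =
    (Nat.bits (d.toRat.num.natAbs / 2 ^ Nat.log 2 d.toRat.den)).reverse.map DyadicSymbol.bit ++
      .point :: lowBits d.toRat.num.natAbs (Nat.log 2 d.toRat.den) := by
  unfold expansion lowBits
  by_cases h : d.toRat < 0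
  · simp [h, dropSign]
  · simp only [h, dropSign]
    rcases e : (Nat.bits (d.toRat.num.natAbs / 2 ^ Nat.log 2 d.toRat.den)).reverse with _ | ⟨b, l⟩
    · simp
    · simp

/-- Without leading zeros, the point directly follows the sign exactly if the integer part is 0. -/
theorem fracDigits_expansion (d : Dyadic) (m : ℕ) : fracDigits m d.expansion =
    if d.toRat.num.natAbs / 2 ^ Nat.log 2 d.toRat.den = 0 then
      lowBits d.toRat.num.natAbs (Nat.log 2 d.toRat.den)
    else List.replicate m (.bit true) ++ dropSign d.expansion := by
  unfold fracDigits
  split_ifs with h1 h2 h2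
  · rw [dropSign_expansion, h2]
    simp
  · exfalso
    rw [dropSign_expansion] at h1
    rcases e : (Nat.bits (d.toRat.num.natAbs / 2 ^ Nat.log 2 d.toRat.den)).reverse with _ | ⟨b, l⟩
    · have h3 := congrArg List.length e
      rw [List.length_reverse, Nat.size_eq_bits_len, List.length_nil, Nat.size_eq_zero] at h3
      exact h2 h3
    · simp [e] at h1
  · exact absurd (by rw [dropSign_expansion, h2]; simp) h1
  · rfl

end Dyadic

/-- The number with the first `j` digits `D`. -/
def digitVal (D : ℕ → Bool) : ℕ → ℕ
  | 0 => 0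
  | j + 1 => 2 * digitVal D j + if D j then 1 else 0

/-- Taking j digits is truncation of m/2^k; for j > k the missing digits count as zeros. -/
theorem digitVal_lowBits {m k : ℕ} (hm : m < 2 ^ k) (j : ℕ) :
    digitVal (digit (lowBits m k)) j = m * 2 ^ j / 2 ^ k := by
  induction j with
  | zero => simp [digitVal, Nat.div_eq_of_lt hm]
  | succ j ih =>
    have h1 : m * 2 ^ (j + 1) / 2 ^ k / 2 = m * 2 ^ j / 2 ^ k := by
      rw [Nat.div_div_eq_div_mul, pow_succ, ← mul_assoc, Nat.mul_div_mul_right _ _ (by norm_num)]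
    have h2 : (if digit (lowBits m k) j then 1 else 0) = m * 2 ^ (j + 1) / 2 ^ k % 2 := by
      rcases lt_or_ge j k with h | h
      · have h3 : m * 2 ^ (j + 1) / 2 ^ k = m / 2 ^ (k - 1 - j) := by
          have : 2 ^ k = 2 ^ (k - 1 - j) * 2 ^ (j + 1) := by
            rw [← pow_add]
            congr 1
            omega
          rw [this, Nat.mul_div_mul_right _ _ (by positivity)]
        have h4 : digit (lowBits m k) j = m.testBit (k - 1 - j) := by
          simp [digit, lowBits, h]
        rw [h3, h4, Nat.testBit_eq_decide_div_mod_eq]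
        rcases Nat.mod_two_eq_zero_or_one (m / 2 ^ (k - 1 - j)) with h5 | h5 <;> simp [h5]
      · have h3 : m * 2 ^ (j + 1) / 2 ^ k = m * 2 ^ (j - k) * 2 := by
          have : m * 2 ^ (j + 1) = m * 2 ^ (j - k) * 2 * 2 ^ k := by
            rw [mul_assoc, mul_assoc, ← pow_succ', ← pow_add]
            congr 2
            omega
          rw [this, Nat.mul_div_cancel _ (by positivity)]
        have h4 : digit (lowBits m k) j = false := by
          simp [digit, lowBits, h]
        rw [h3, h4]
        simp
    rw [digitVal, ih, h2]
    omega

theorem digitVal_replicate {m : ℕ} {l : List DyadicSymbol} {j : ℕ} (hj : j ≤ m) :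
    digitVal (digit (List.replicate m (.bit true) ++ l)) j = 2 ^ j - 1 := by
  induction j with
  | zero => rfl
  | succ j ih =>
    have h : digit (List.replicate m (.bit true) ++ l) j = true := by
      simp [digit, List.getElem?_append, show j < m by omega]
    have := Nat.one_le_two_pow (n := j)
    rw [digitVal, ih (by omega), h, pow_succ]
    simp
    omega

/-- The digits read by the machine are the digits of an approximation. -/
theorem abs_digitVal_sub_le {x : ℝ} (hx : 0 ≤ x) (hx' : x ≤ 1) {φ : ℕ → Dyadic} (hφ : φ ∈ CF x)
    {m j : ℕ} (hj : j ≤ m) :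
    |(digitVal (digit (fracDigits m (φ m).expansion)) j : ℝ) / 2 ^ j - x| ≤ 2 / 2 ^ j := by
  set N := (φ m).toRat.num.natAbs with hN
  set K := Nat.log 2 (φ m).toRat.den with hK
  -- Dropping the sign does no harm: since x ≥ 0, the absolute value is no farther from x. A second
  -- 1/2^j is left for cutting off digits.
  have h1 : |((N : ℝ) / 2 ^ K) - x| ≤ 1 / 2 ^ j := by
    rw [← Dyadic.abs_toRat]
    have h2 : (1 : ℝ) / 2 ^ m ≤ 1 / 2 ^ j := by
      gcongr
      norm_num
    have h3 := hφ m
    rw [zpow_neg, zpow_natCast, ← one_div] at h3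
    have h4 := abs_abs_sub_abs_le ((φ m).toRat : ℝ) x
    rw [abs_of_nonneg hx] at h4
    linarith
  have hj' : (0 : ℝ) < 2 ^ j := by positivity
  have hd : (2 : ℝ) / 2 ^ j = 1 / 2 ^ j + 1 / 2 ^ j := by ring
  have hd' : (0 : ℝ) < 1 / 2 ^ j := by positivity
  rw [abs_le] at h1 ⊢
  rw [Dyadic.fracDigits_expansion]
  split_ifs with h
  · rw [digitVal_lowBits (Nat.lt_of_div_eq_zero (by positivity) h)]
    have hK' : (0 : ℝ) < 2 ^ K := by positivity
    have h5 : ((N * 2 ^ j / 2 ^ K : ℕ) : ℝ) ≤ N * 2 ^ j / 2 ^ K := by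
      refine (Nat.cast_div_le).trans (le_of_eq ?_)
      push_cast
      rfl
    have h6 : (N * 2 ^ j / 2 ^ K : ℝ) ≤ ((N * 2 ^ j / 2 ^ K : ℕ) : ℝ) + 1 := by
      rw [div_le_iff₀ hK']
      exact_mod_cast (Nat.lt_div_mul_add (a := N * 2 ^ j) (b := 2 ^ K) (by positivity)).le.trans (by rw [Nat.add_mul, one_mul])
    have h7 : ((N * 2 ^ j / 2 ^ K : ℕ) : ℝ) / 2 ^ j ≤ N / 2 ^ K := by
      rw [div_le_iff₀ hj']
      exact h5.trans (le_of_eq (by ring))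
    have h8 : (N : ℝ) / 2 ^ K ≤ ((N * 2 ^ j / 2 ^ K : ℕ) : ℝ) / 2 ^ j + 1 / 2 ^ j := by
      rw [← add_div, le_div_iff₀ hj']
      exact (le_of_eq (by ring)).trans h6
    constructor <;> linarith
  -- Here the approximation is at least 1, which forces 1 - 1/2^j ≤ x ≤ 1, so the digits 0.11...1
  -- are close enough.
  · rw [digitVal_replicate hj]
    have h5 : (1 : ℝ) ≤ N / 2 ^ K := by
      rw [le_div_iff₀ (by positivity), one_mul]
      exact_mod_cast (Nat.div_ne_zero_iff.1 h).2
    have h6 : (((2 ^ j - 1 : ℕ) : ℝ)) / 2 ^ j = 1 - 1 / 2 ^ j := by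
      rw [Nat.cast_sub Nat.one_le_two_pow]
      push_cast
      rw [sub_div, div_self hj'.ne']
    rw [h6]
    constructor <;> linarith

/-! ### The error of the approximation -/

/-- The accumulator stores A + `den`, where A is doubled and increased by `den` for a digit 1; this
is why `den` is subtracted for a digit 0. Clamping early loses nothing: A ≥ P implies 2A ≥ P, and A
≤ -`den` implies 2A + `den` ≤ -`den`. -/
theorem accVal_eq {P den p : ℕ} (D : ℕ → Bool) (hp : p < den) (j : ℕ) :
    (accVal (P + den) den D (den - p) j : ℤ) =
      max 0 (min ((P : ℤ) + den) ((den : ℤ) * digitVal D j - p * 2 ^ j + den)) := by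
  induction j with
  | zero =>
    simp only [accVal, digitVal]
    push_cast [hp.le]
    omega
  | succ j ih =>
    have h : (den : ℤ) * digitVal D (j + 1) - p * 2 ^ (j + 1) =
        2 * ((den : ℤ) * digitVal D j - p * 2 ^ j) + if D j then (den : ℤ) else 0 := by
      simp only [digitVal]
      push_cast
      split_ifs <;> ring
    rw [h]
    -- With the products hidden in A, what remains is piecewise linear.
    generalize (den : ℤ) * digitVal D j - p * 2 ^ j = A at *
    simp only [accVal]
    split_ifs <;> simp <;> omega

theorem accVal_sub_eq {P den p : ℕ} (D : ℕ → Bool) (hp : p < den) (j : ℕ) :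
    ((accVal (P + den) den D (den - p) j - den : ℕ) : ℝ) =
      max 0 (min (P : ℝ) ((den : ℝ) * digitVal D j - p * 2 ^ j)) := by
  have h := accVal_eq (P := P) D hp j
  have h2 : ((accVal (P + den) den D (den - p) j - den : ℕ) : ℤ) =
      max 0 (min (P : ℤ) ((den : ℤ) * digitVal D j - p * 2 ^ j)) := by omega
  have h3 := congrArg (Int.cast : ℤ → ℝ) h2
  push_cast at h3
  exact h3

/-- As a clamped affine function, `beta` can be compared with the accumulator, and its Lipschitz
constant is the slope 2^q. -/
theorem beta_eq {p q : ℕ} (hq : 0 < q) (x : ℝ) :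
    beta p q x = max 0 (min (1 / q : ℝ) (2 ^ q * (x - p / q))) := by
  have hq' : (0 : ℝ) < q := by exact_mod_cast hq
  have h2 : (0 : ℝ) < 2 ^ q := by positivity
  have h3 : x ≤ ((p : ℝ) + 1 / 2 ^ q) / q ↔ 2 ^ q * (x - p / q) ≤ 1 / q := by
    rw [add_div, ← sub_le_iff_le_add', div_div, mul_comm ((2 : ℝ) ^ q) (q : ℝ), ← div_div,
      le_div_iff₀ h2, mul_comm]
  unfold beta
  split_ifs with h h'
  · rw [max_eq_left]
    exact (min_le_right _ _).trans (mul_nonpos_of_nonneg_of_nonpos h2.le (by linarith))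
  · rw [min_eq_right (h3.1 h'), max_eq_right]
    exact mul_nonneg h2.le (by linarith)
  · rw [min_eq_left (le_of_lt (not_le.1 (h3.not.1 h'))), max_eq_right (by positivity)]

theorem abs_beta_sub_beta_le {p q : ℕ} (hq : 0 < q) (x y : ℝ) :
    |beta p q x - beta p q y| ≤ 2 ^ q * |x - y| := by
  rw [beta_eq hq, beta_eq hq]
  refine (abs_max_sub_max_le_max _ _ _ _).trans (max_le (by simp)
    ((abs_min_sub_min_le_max _ _ _ _).trans (max_le (by simp) ?_)))
  rw [← mul_sub, sub_sub_sub_cancel_right, abs_mul, abs_of_pos (by positivity)]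

theorem abs_alpha_sub_alpha_le {q : ℕ} (hq : 0 < q) (x y : ℝ) :
    |alpha q x - alpha q y| ≤ q * (2 ^ q * |x - y|) := by
  unfold alpha
  rw [← Finset.sum_sub_distrib]
  refine (Finset.abs_sum_le_sum_abs _ _).trans ?_
  refine (Finset.sum_le_card_nsmul _ _ _ fun p _ => abs_beta_sub_beta_le hq x y).trans ?_
  simp

/-- No rounding occurs: with k + `den` digits, the factor `den` · 2^k turns both arguments of the
minimum in `beta_eq` into integers. Reflecting the sum matches the start value i + 1 with `den - p`.
-/
theorem sumVal_eq {k den : ℕ} (hden : 0 < den) (D : ℕ → Bool) :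
    (sumVal (2 ^ k + den) den D (k + den) : ℝ) =
      den * 2 ^ k * alpha den (digitVal D (k + den) / 2 ^ (k + den)) := by
  have hq' : (0 : ℝ) < den := by exact_mod_cast hden
  unfold sumVal alpha
  rw [← Finset.sum_range_reflect, Nat.cast_sum, Finset.mul_sum]
  refine Finset.sum_congr rfl fun p hp => ?_
  have hp' := Finset.mem_range.1 hp
  rw [show den - 1 - p + 1 = den - p by omega, accVal_sub_eq D hp', beta_eq hden,
    mul_max_of_nonneg _ _ (by positivity), mul_min_of_nonneg _ _ (by positivity), mul_zero]
  congr 2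
  · push_cast
    field_simp
  · rw [pow_add]
    field_simp

theorem ceilDiv'_bounds (j G : ℕ) : (G : ℝ) / (j + 1 : ℕ) ≤ ceilDiv' j G ∧
    (ceilDiv' j G : ℝ) ≤ (G : ℝ) / (j + 1 : ℕ) + 1 := by
  have hj : (0 : ℝ) < (j + 1 : ℕ) := by positivity
  have h1 : G ≤ ceilDiv' j G * (j + 1) := by
    have := Nat.lt_div_mul_add (a := G + j) (b := j + 1) (by omega)
    unfold ceilDiv'
    omega
  have h2 : ceilDiv' j G * (j + 1) ≤ G + j := Nat.div_mul_le_self _ _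
  constructor
  · rw [div_le_iff₀ hj]
    exact_mod_cast h1
  · rw [← sub_le_iff_le_add, le_div_iff₀ hj, sub_mul]
    have h3 : ((ceilDiv' j G : ℕ) : ℝ) * (j + 1 : ℕ) ≤ G + (j + 1 : ℕ) := by
      exact_mod_cast h2.trans (by omega)
    linarith

/-- In units of 2^(-k), the three roundings cost at most 3, since earlier ones are only shrunk by
later divisions. The digits of x cost q·2^q·2/2^q = 2q, which the weight 1/q² reduces to at most 2.
-/
theorem abs_termVal_sub_le {k j : ℕ} {D : ℕ → Bool} {x : ℝ}
    (hx : |(digitVal D (k + (j + 1)) : ℝ) / 2 ^ (k + (j + 1)) - x| ≤ 2 / 2 ^ (k + (j + 1))) :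
    |(termVal (2 ^ k) k D j : ℝ) / 2 ^ k - 1 / ((j + 1 : ℕ) : ℝ) ^ 2 * alpha (j + 1) x| ≤
      5 / 2 ^ k := by
  unfold termVal
  have hG := sumVal_eq (k := k) (Nat.succ_pos j) D
  have hA := abs_alpha_sub_alpha_le (Nat.succ_pos j)
    ((digitVal D (k + (j + 1)) : ℝ) / 2 ^ (k + (j + 1))) x
  rw [Nat.succ_eq_add_one] at hG hA
  generalize sumVal (2 ^ k + (j + 1)) (j + 1) D (k + (j + 1)) = G at hG ⊢
  obtain ⟨l1, u1⟩ := ceilDiv'_bounds j G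
  obtain ⟨l2, u2⟩ := ceilDiv'_bounds j (ceilDiv' j G)
  obtain ⟨l3, u3⟩ := ceilDiv'_bounds j (ceilDiv' j (ceilDiv' j G))
  generalize ceilDiv' j (ceilDiv' j (ceilDiv' j G)) = c3 at *
  generalize ceilDiv' j (ceilDiv' j G) = c2 at *
  generalize ceilDiv' j G = c1 at *
  have hq : (1 : ℝ) ≤ ((j + 1 : ℕ) : ℝ) := by exact_mod_cast Nat.succ_pos j
  have hk : (0 : ℝ) < 2 ^ k := by positivity
  set q : ℝ := ((j + 1 : ℕ) : ℝ) with hqdef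
  have hq0 : 0 < q := by linarith
  set y := (digitVal D (k + (j + 1)) : ℝ) / 2 ^ (k + (j + 1))
  have hA' : |alpha (j + 1) y - alpha (j + 1) x| ≤ 2 * q / 2 ^ k := by
    refine hA.trans ?_
    calc q * (2 ^ (j + 1) * |y - x|) ≤ q * (2 ^ (j + 1) * (2 / 2 ^ (k + (j + 1)))) := by gcongr
      _ = 2 * q / 2 ^ k := by
        rw [pow_add 2 k (j + 1)]
        field_simp
  have div_le : ∀ z : ℝ, 0 ≤ z → z / q ≤ z := fun z hz => div_le_self hz hq
  have e : (G : ℝ) / q / q / q = 2 ^ k * (1 / q ^ 2 * alpha (j + 1) y) := by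
    rw [hG]
    field_simp
  have L : (G : ℝ) / q / q / q ≤ c3 := by
    calc (G : ℝ) / q / q / q ≤ c1 / q / q := by gcongr
      _ ≤ c2 / q := by gcongr
      _ ≤ c3 := l3
  have U : (c3 : ℝ) ≤ (G : ℝ) / q / q / q + 3 := by
    calc (c3 : ℝ) ≤ c2 / q + 1 := u3
      _ ≤ (c1 / q + 1) / q + 1 := by gcongr
      _ ≤ ((G / q + 1) / q + 1) / q + 1 := by gcongr
      _ = G / q / q / q + (1 / q / q + 1 / q + 1) := by ring
      _ ≤ G / q / q / q + 3 := by
        have h1 := div_le 1 zero_le_one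
        have h2 := div_le (1 / q) (by positivity)
        linarith
  rw [e] at L U
  have h1 : |(c3 : ℝ) / 2 ^ k - 1 / q ^ 2 * alpha (j + 1) y| ≤ 3 / 2 ^ k := by
    rw [abs_le]
    constructor
    · have : 1 / q ^ 2 * alpha (j + 1) y ≤ c3 / 2 ^ k := by
        rw [le_div_iff₀ hk]
        linarith
      have : (0 : ℝ) ≤ 3 / 2 ^ k := by positivity
      linarith
    · rw [sub_le_iff_le_add, div_le_iff₀ hk, add_mul, div_mul_cancel₀ _ hk.ne']
      linarith
  have h2 : |1 / q ^ 2 * alpha (j + 1) y - 1 / q ^ 2 * alpha (j + 1) x| ≤ 2 / 2 ^ k := by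
    rw [← mul_sub, abs_mul, abs_of_pos (by positivity : (0 : ℝ) < 1 / q ^ 2)]
    calc 1 / q ^ 2 * |alpha (j + 1) y - alpha (j + 1) x| ≤ 1 / q ^ 2 * (2 * q / 2 ^ k) := by gcongr
      _ = (2 / 2 ^ k) / q := by field_simp
      _ ≤ 2 / 2 ^ k := div_le _ (by positivity)
  calc |(c3 : ℝ) / 2 ^ k - 1 / q ^ 2 * alpha (j + 1) x| ≤
      |(c3 : ℝ) / 2 ^ k - 1 / q ^ 2 * alpha (j + 1) y| +
        |1 / q ^ 2 * alpha (j + 1) y - 1 / q ^ 2 * alpha (j + 1) x| := abs_sub_le _ _ _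
    _ ≤ 3 / 2 ^ k + 2 / 2 ^ k := add_le_add h1 h2
    _ = 5 / 2 ^ k := by ring

theorem abs_sum_sub_F_le {N : ℕ} (hN : 0 < N) (x : Set.Icc (0 : ℝ) 1) :
    |∑ j ∈ Finset.range N, 1 / ((j + 1 : ℕ) : ℝ) ^ 2 * alpha (j + 1) x - F x| ≤ 1 / (N : ℝ) := by
  have hs := F_summable x
  have hnn : ∀ j : ℕ, 0 ≤ 1 / ((j + 1 : ℕ) : ℝ) ^ 2 * alpha (j + 1) x := fun j =>
    mul_nonneg (by positivity) (alpha_mem _ (by omega) _).1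
  have h1 := hs.sum_add_tsum_nat_add N
  have h2 : ∑' j : ℕ, 1 / ((j + N + 1 : ℕ) : ℝ) ^ 2 * alpha (j + N + 1) x ≤
      1 / (N : ℝ) := by
    refine Real.tsum_le_of_sum_range_le (fun j => hnn _) fun M => ?_
    -- Telescoping, by 1/q² ≤ 1/(q-1) - 1/q.
    have h3 : ∑ j ∈ Finset.range M, 1 / ((j + N + 1 : ℕ) : ℝ) ^ 2 * alpha (j + N + 1) x ≤
        1 / (N : ℝ) - 1 / ((M + N : ℕ) : ℝ) := by
      induction M with
      | zero => simp
      | succ M ih =>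
        rw [Finset.sum_range_succ]
        have h4 : 1 / ((M + N + 1 : ℕ) : ℝ) ^ 2 * alpha (M + N + 1) x ≤
            1 / ((M + N + 1 : ℕ) : ℝ) ^ 2 :=
          mul_le_of_le_one_right (by positivity) (alpha_mem _ (by omega) _).2
        have h5 : 1 / ((M + N + 1 : ℕ) : ℝ) ^ 2 ≤
            1 / ((M + N : ℕ) : ℝ) - 1 / ((M + 1 + N : ℕ) : ℝ) := by
          have h6 : (0 : ℝ) < ((M + N : ℕ) : ℝ) := by exact_mod_cast Nat.add_pos_right M hN
          rw [show M + 1 + N = M + N + 1 by omega]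
          push_cast at h6 ⊢
          rw [div_sub_div _ _ h6.ne' (by positivity), div_le_div_iff₀ (by positivity)
            (by positivity)]
          nlinarith
        linarith
    have : (0 : ℝ) ≤ 1 / ((M + N : ℕ) : ℝ) := by positivity
    linarith
  have h3 : 0 ≤ ∑' j : ℕ, 1 / ((j + N + 1 : ℕ) : ℝ) ^ 2 * alpha (j + N + 1) x :=
    tsum_nonneg fun j => hnn _
  have h4 : F x = ∑ j ∈ Finset.range N, 1 / ((j + 1 : ℕ) : ℝ) ^ 2 * alpha (j + 1) x +
      ∑' j : ℕ, 1 / ((j + N + 1 : ℕ) : ℝ) ^ 2 * alpha (j + N + 1) x := h1.symm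
  rw [h4, abs_le]
  constructor <;> linarith

theorem abs_totalVal_sub_F_le {n : ℕ} {x : Set.Icc (0 : ℝ) 1} {φ : ℕ → Dyadic} (hφ : φ ∈ CF x) :
    |(totalVal (4 ^ (n + 3)) (2 * (n + 3))
      (digit (fracDigits (2 ^ (n + 3) + 2 * (n + 3))
        (φ (2 ^ (n + 3) + 2 * (n + 3))).expansion)) (2 ^ (n + 3)) : ℝ) / 2 ^ (2 * (n + 3)) - F x| ≤
      (6 : ℝ) / 2 ^ (n + 3) := by
  set D := digit (fracDigits (2 ^ (n + 3) + 2 * (n + 3))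
        (φ (2 ^ (n + 3) + 2 * (n + 3))).expansion) with hD
  have h4 : 4 ^ (n + 3) = 2 ^ (2 * (n + 3)) := by rw [pow_mul]; norm_num
  set N := 2 ^ (n + 3) with hN
  have h1 : |∑ j ∈ Finset.range N, ((termVal (2 ^ (2 * (n + 3))) (2 * (n + 3)) D j : ℝ) /
      2 ^ (2 * (n + 3)) - 1 / ((j + 1 : ℕ) : ℝ) ^ 2 * alpha (j + 1) x)| ≤
      (N : ℝ) * (5 / 2 ^ (2 * (n + 3))) := by
    refine (Finset.abs_sum_le_sum_abs _ _).trans ((Finset.sum_le_card_nsmul _ _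
      ((5 : ℝ) / 2 ^ (2 * (n + 3))) fun j hj => abs_termVal_sub_le ?_).trans (by simp))
    exact abs_digitVal_sub_le x.2.1 x.2.2 hφ (by have := Finset.mem_range.1 hj; omega)
  have h2 := abs_sum_sub_F_le (N := N) (by positivity) x
  -- The precision 2(n+3) is chosen so that 2^(2(n+3)) = N², which leaves 5/N after adding N errors.
  have h3 : (N : ℝ) * (5 / 2 ^ (2 * (n + 3))) = 5 / 2 ^ (n + 3) := by
    rw [hN, two_mul, pow_add 2 (n + 3) (n + 3)]
    push_cast
    field_simp
  have h5 : (1 : ℝ) / N = 1 / 2 ^ (n + 3) := by rw [hN]; push_cast; rfl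
  rw [h4, totalVal, Nat.cast_sum, Finset.sum_div]
  rw [Finset.sum_sub_distrib, h3] at h1
  rw [h5] at h2
  refine (abs_sub_le _ _ _).trans ((add_le_add h1 h2).trans (le_of_eq ?_))
  ring

/-! ### The machine for `F` -/

/-- The program after the query. -/
def answerProg : StackProg Stack DyadicSymbol := fracProg ;; totalProg ;; outProg

/-- The output of the machine. -/
def outputVal (φ : ℕ → Dyadic) (n : ℕ) : Dyadic :=
  .ofOdd (2 * (totalVal (4 ^ (n + 3)) (2 * (n + 3))
      (digit (fracDigits (2 ^ (n + 3) + 2 * (n + 3))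
        (φ (2 ^ (n + 3) + 2 * (n + 3))).expansion)) (2 ^ (n + 3)) : ℕ) + 1)
    ((2 * (n + 3) + 1 : ℕ) : ℤ) (by omega)

theorem outputVal_mem_CF {x : Set.Icc (0 : ℝ) 1} {φ : ℕ → Dyadic} (hφ : φ ∈ CF x) :
    outputVal φ ∈ CF (F x) := by
  intro n
  have h := abs_totalVal_sub_F_le (n := n) hφ
  unfold outputVal
  rw [Dyadic.toRat_ofOdd_two_mul_add_one]
  generalize totalVal _ _ _ _ = T at h ⊢
  have h1 : ((((2 * (T : ℤ) + 1 : ℤ) : ℚ) / ((2 ^ (2 * (n + 3) + 1) : ℤ) : ℚ) : ℚ) : ℝ) =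
      T / 2 ^ (2 * (n + 3)) + 1 / 2 ^ (2 * (n + 3) + 1) := by
    push_cast
    rw [pow_succ (2 : ℝ) (2 * (n + 3))]
    field_simp
  have h2 : (1 : ℝ) / 2 ^ (2 * (n + 3) + 1) ≤ 1 / 2 ^ (n + 3) := by
    exact one_div_le_one_div_of_le (by positivity) (pow_le_pow_right₀ (by norm_num) (by omega))
  -- The shift by 3 in n + 3 suffices because 6 + 1 ≤ 8; the extra 1 pays for the appended output
  -- digit.
  have h3 : (6 : ℝ) / 2 ^ (n + 3) + 1 / 2 ^ (n + 3) ≤ 2 ^ (-(n : ℤ)) := by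
    rw [zpow_neg, zpow_natCast, pow_add, ← add_div, ← one_div, div_le_div_iff₀ (by positivity)
      (by positivity)]
    have : (0 : ℝ) < 2 ^ n := by positivity
    nlinarith
  have h4 : (0 : ℝ) ≤ 1 / 2 ^ (2 * (n + 3) + 1) := by positivity
  rw [h1]
  rw [abs_le] at h ⊢
  constructor <;> linarith

theorem describes_initView (n : ℕ) : (initView n).Describes
    (Function.update (fun _ => []) (.cnt .arg) (List.replicate n (DyadicSymbol.bit true))) := by
  refine ⟨fun r => ?_, ?_, ?_, ?_⟩
  · by_cases h : r = .arg
    · subst h; simp [initView]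
    · simp [initView, h]
  all_goals simp [initView]

theorem run_answerProg (φ : ℕ → Dyadic) (n : ℕ) :
    ∃ w, w.out = (outputVal φ n).expansion ∧ Run (2 ^ (5 * (n + 3)))
      (setupView (n + 3) (n + 3) {(φ (2 ^ (n + 3) + 2 * (n + 3))).expansion}) answerProg w := by
  set N := 2 ^ (n + 3) with hN
  set m := N + 2 * (n + 3) with hm
  have hN8 : 8 ≤ N := by
    rw [hN, pow_add]
    have := Nat.one_le_two_pow (n := n)
    omega
  have hnN : n + 3 < N := Nat.lt_two_pow_self
  have hB : 2 ^ (5 * (n + 3)) = N ^ 5 := by rw [hN, ← pow_mul, mul_comm]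
  have hc : 4 ^ (n + 3) = N ^ 2 := by
    rw [hN, ← pow_mul, mul_comm, pow_mul]
    norm_num
  have h2 : N ^ 2 = N * N := sq N
  -- These inequalities let `omega` treat the powers of N as atoms. The total is at most N^4, so N^5
  -- bounds every loop with room for constant factors.
  have h3 : 8 * N ≤ N ^ 2 := by rw [h2]; exact Nat.mul_le_mul_right _ hN8
  have h4 : 8 * N ^ 2 ≤ N ^ 3 := by rw [pow_succ N 2, mul_comm]; exact Nat.mul_le_mul_left _ hN8
  have h5 : 8 * N ^ 3 ≤ N ^ 4 := by rw [pow_succ N 3, mul_comm]; exact Nat.mul_le_mul_left _ hN8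
  have h6 : 8 * N ^ 4 ≤ N ^ 5 := by rw [pow_succ N 4, mul_comm]; exact Nat.mul_le_mul_left _ hN8
  set l := (φ m).expansion
  set D := digit (fracDigits m l) with hD
  have hT := totalVal_le (c := 4 ^ (n + 3)) (k := 2 * (n + 3)) (D := D) (N := N)
  rw [hc, show N * (N * N ^ 2) = N ^ 4 by ring] at hT
  have hNc : N * N ^ 2 = N ^ 3 := by ring
  refine ⟨_, ?_, ((run_fracProg rfl ?_ ?_ rfl rfl).weaken_query (s := withDigits D) ?_).seq
    ((run_totalProg (N := N) (c := 4 ^ (n + 3)) (k := 2 * (n + 3)) D rfl rfl rfl rfl rfl rfl rfl rfl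
      rfl rfl ?_ rfl rfl rfl rfl ?_ ?_ ?_ rfl).seq (run_outProg (k := 2 * (n + 3))
      (T := totalVal (4 ^ (n + 3)) (2 * (n + 3)) D N) rfl rfl ?_ ?_ ?_ ?_ rfl rfl))⟩
  · rw [outputVal, Dyadic.expansion_ofOdd]
  · rw [hB]
    change N ≤ _
    omega
  · rw [hB]
    change 2 * (n + 3) ≤ _
    omega
  · rintro l' (rfl : l' = _)
    rfl
  · rfl
  · omega
  · omega
  · rw [hc, hNc]
    omega
  · simp [totalView, setupView]
  · simp [totalView, setupView]
  · rw [hc]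
    omega
  · omega

theorem outputsWithin_outputVal (φ : ℕ → Dyadic) (n : ℕ) :
    (queryMachine Stack (.cnt .arg) .out .query setupProg answerProg).OutputsWithin φ n
      (outputVal φ n) (setupProg.cost (2 ^ (5 * (n + 3))) +
        answerProg.cost (2 ^ (5 * (n + 3))) + 2) := by
  obtain ⟨S, h1, h2⟩ := run_setupProg (n := n) (B := 2 ^ (5 * (n + 3)))
    (by rw [show 4 = 2 ^ 2 by rfl, ← pow_mul]; exact Nat.pow_le_pow_right (by norm_num) (by omega))
    _ (describes_initView n)
  have hq : (S .query).length = 2 ^ (n + 3) + 2 * (n + 3) := by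
    rw [show S .query = _ from h2.query, List.length_replicate]
  obtain ⟨w, hw, hrun⟩ := run_answerProg φ n
  have hd : (setupView (n + 3) (n + 3) {(φ (2 ^ (n + 3) + 2 * (n + 3))).expansion}).Describes
      (Function.update S .query (φ (S .query).length).expansion) := by
    refine ⟨fun r => ?_, ?_, ?_, ?_⟩
    · rw [Function.update_of_ne (by simp)]
      exact h2.cnt r
    · rw [hq]
      simp [setupView]
    · rw [Function.update_of_ne (by simp)]
      exact h2.aux
    · rw [Function.update_of_ne (by simp)]
      exact h2.out
  obtain ⟨S', h3, h4⟩ := hrun _ hd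
  exact outputsWithin_queryMachine h1 h3 (h4.out.trans hw)

theorem mainTheorem2 : F ∈ FEXPTIME 0 1 := by
  obtain ⟨E₁, hE₁⟩ := exists_cost_le_pow setupProg
  obtain ⟨E₂, hE₂⟩ := exists_cost_le_pow answerProg
  -- With B = 2^(5(n+3)) the time is at most B^(E₁+E₂+2), where B² absorbs the constant 4; the
  -- factor 15 comes from 5(n+3) ≤ 15(n+1).
  refine ⟨queryMachine Stack (.cnt .arg) .out .query setupProg answerProg,
    15 * (E₁ + E₂ + 2), fun x φ hφ => ⟨outputVal φ, outputVal_mem_CF hφ, fun n => ?_⟩⟩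
  obtain ⟨t, ht, h⟩ := outputsWithin_outputVal φ n
  refine ⟨t, ht.trans ?_, h⟩
  set B := 2 ^ (5 * (n + 3)) with hB
  have hB4 : 4 ≤ B := by
    rw [hB, show 4 = 2 ^ 2 by rfl]
    exact Nat.pow_le_pow_right (by norm_num) (by omega)
  have h1 := hE₁ B (by omega)
  have h2 := hE₂ B (by omega)
  have h3 : B ^ E₁ ≤ B ^ (E₁ + E₂) := Nat.pow_le_pow_right (by omega) (by omega)
  have h4 : B ^ E₂ ≤ B ^ (E₁ + E₂) := Nat.pow_le_pow_right (by omega) (by omega)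
  have h5 : 1 ≤ B ^ (E₁ + E₂) := Nat.one_le_pow _ _ (by omega)
  calc setupProg.cost B + answerProg.cost B + 2 ≤ B ^ (E₁ + E₂) * 4 := by omega
    _ ≤ B ^ (E₁ + E₂) * B ^ 2 := by gcongr; nlinarith
    _ = 2 ^ (5 * (n + 3) * (E₁ + E₂ + 2)) := by rw [← pow_add, hB, ← pow_mul]
    _ ≤ 2 ^ (15 * (E₁ + E₂ + 2) * (n + 1)) := by
      refine Nat.pow_le_pow_right (by norm_num) ?_
      calc 5 * (n + 3) * (E₁ + E₂ + 2) ≤ 15 * (n + 1) * (E₁ + E₂ + 2) :=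
            Nat.mul_le_mul_right _ (by omega)
        _ = 15 * (E₁ + E₂ + 2) * (n + 1) := by ring
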